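/- All objects are over $\mathbb C$ and $\mathbb Z_2$-graded, with the usual sign rule in tensor products. Let $m,n\ge 0$, let $[a]=\bar 0$ for $a\le m$ and $[a]=\bar 1$ for $m<a\le m+n$. Let $\mathfrak g=\mathfrak{sl}(m|n)$ be the Lie superalgebra of $(m+n)\times(m+n)$ matrices with vanishing supertrace, $\mathfrak g_{\bar 0}$ its even part, and $U(\mathfrak g)$, $U(\mathfrak g_{\bar 0})$ the enveloping algebras with their standard Hopf structures. The dual $U(\mathfrak g)^*$ is an algebra with product $\langle ab,x\rangle=\langle a\otimes b,\Delta x\rangle$, where $\langle a\otimes b,x\otimes y\rangle=(-1)^{[b][x]}\langle a,x\rangle\langle b,y\rangle$. Let $t$ be the vector representation of $\mathfrak g$ and $\bar t$ its dual representation, $\bar t(x)_{ba}=-(-1)^{[a]([a]+[b])}x_{ab}$ for $x\in\mathfrak g$, and let $\mathcal A\subset U(\mathfrak g)^*$ be the Hopf superalgebra generated by the matrix elements $t_{ab},\bar t_{ab}$; its coproduct is determined by $\langle\Delta a,x\otimes y\rangle=\langle a,xy\rangle$. Let $\mathcal P$ be the restriction of linear forms from $U(\mathfrak g)$ to $U(\mathfrak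 g_{\bar 0})$, and $\mathcal A_e=\mathcal P(\mathcal A)$, with the coproduct dual to the multiplication of $U(\mathfrak g_{\bar 0})$. A linear form $I$ is a left integral if $(\mathrm{id}\otimes I)\Delta=1\,I$ and a right integral if $(I\otimes\mathrm{id})\Delta=1\,I$. Let $\nu:U(\mathfrak g)\to\mathcal A^*$, $\langle\nu(x),a\rangle=(-1)^{[x][a]}\langle a,x\rangle$, and let $\cdot$ be the product of $\mathcal A^*$ deduced from $\Delta$. Put $\Gamma=\mathbb E\,\mathbb F$ with $$\mathbb E=\mathbb E_m\cdots\mathbb E_1,\quad \mathbb E_i=E_{i,m+1}E_{i,m+2}\cdots E_{i,m+n},\qquad \mathbb F=\mathbb F_1\cdots\mathbb F_m,\quad \mathbb F_i=E_{m+n,i}\cdots E_{m+2,i}E_{m+1,i},$$ and $$\Theta=\Theta_m\cdots\Theta_1,\quad \Theta_i=t_{i,m+n}\cdots t_{i,m+1},\qquad \bar\Theta=\bar\Theta_m\cdots\bar\Theta_1,\quad \bar\Theta_i=\bar t_{i,m+n}\cdots\bar t_{i,m+1}.$$ Theorem. There is a unique left integral $\int_0$ on $\mathcal A_e$ with $\int_0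 1=1$. The linear form $\int=\nu(\Gamma)\cdot\int_0\mathcal P$ on $\mathcal A$ is non-zero and is both a left and a right integral on $\mathcal A$. Explicitly, $\int\Theta\bar\Theta=(-1)^{mn(mn+1)/2}$. -/

import Mathlib

open scoped TensorProduct

noncomputable section

namespace SuperInt

/-! ### Superspaces

The `ℤ/2`-grading of a complex superspace `V` is carried by its parity operator `π`
(`+1` on even vectors, `-1` on odd vectors). An ordinary space has `π = id`. -/

section Superspace

variable {V : Type*} [AddCommGroup V] [Module ℂ V]

/-- The even homogeneous component of a linear form. -/
def formEven (π : V →ₗ[ℂ] V) : Module.Dual ℂ V →ₗ[ℂ] Module.Dual ℂ V :=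
  (2⁻¹ : ℂ) • (LinearMap.id + π.dualMap)

/-- The odd homogeneous component of a linear form. -/
def formOdd (π : V →ₗ[ℂ] V) : Module.Dual ℂ V →ₗ[ℂ] Module.Dual ℂ V :=
  (2⁻¹ : ℂ) • (LinearMap.id - π.dualMap)

/-- The sign operator `f ⊗ g ↦ (-1) ^ ([f] [g]) f ⊗ g`. -/
def koszul (π : V →ₗ[ℂ] V) :
    Module.Dual ℂ V ⊗[ℂ] Module.Dual ℂ V →ₗ[ℂ] Module.Dual ℂ V ⊗[ℂ] Module.Dual ℂ V :=
  TensorProduct.map LinearMap.id (formEven π) + TensorProduct.map π.dualMap (formOdd π)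

/-- The graded pairing `⟨f ⊗ g, x ⊗ y⟩ = (-1) ^ ([g] [x]) f(x) g(y)`. (The sign may be written
`(-1) ^ ([g] [f])`, since `f(x) = 0` unless `[f] = [x]`.) -/
def gradedPairing (π : V →ₗ[ℂ] V) :
    Module.Dual ℂ V ⊗[ℂ] Module.Dual ℂ V →ₗ[ℂ] Module.Dual ℂ (V ⊗[ℂ] V) :=
  TensorProduct.dualDistrib ℂ V V ∘ₗ koszul π

/-- The product `f · g = (f ⊗ g) ∘ Δ` of linear forms on a supercoalgebra. -/
def formMul (π : V →ₗ[ℂ] V) (Δ : V →ₗ[ℂ] V ⊗[ℂ] V) (f g : Module.Dual ℂ V) :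
    Module.Dual ℂ V :=
  gradedPairing π (f ⊗ₜ g) ∘ₗ Δ

/-- The map `id ⊗ I`, i.e. `v ⊗ w ↦ (-1) ^ ([I] [v]) I(w) v`. -/
def idTensor (π : V →ₗ[ℂ] V) (I : Module.Dual ℂ V) : V ⊗[ℂ] V →ₗ[ℂ] V :=
  (TensorProduct.rid ℂ V).toLinearMap ∘ₗ
    (TensorProduct.map LinearMap.id (formEven π I) + TensorProduct.map π (formOdd π I))

/-- The map `I ⊗ id`, i.e. `v ⊗ w ↦ I(v) w`. -/
def tensorId (I : Module.Dual ℂ V) : V ⊗[ℂ] V →ₗ[ℂ] V :=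
  (TensorProduct.lid ℂ V).toLinearMap ∘ₗ TensorProduct.map I LinearMap.id

/-- `I` is a left integral: `(id ⊗ I) Δ = 1 I`. -/
def IsLeftIntegral (π : V →ₗ[ℂ] V) (Δ : V →ₗ[ℂ] V ⊗[ℂ] V) (one : V)
    (I : Module.Dual ℂ V) : Prop :=
  ∀ a, idTensor π I (Δ a) = I a • one

/-- `I` is a right integral: `(I ⊗ id) Δ = 1 I`. -/
def IsRightIntegral (Δ : V →ₗ[ℂ] V ⊗[ℂ] V) (one : V) (I : Module.Dual ℂ V) : Prop :=
  ∀ a, tensorId I (Δ a) = I a • one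

theorem formEven_apply (π : V →ₗ[ℂ] V) (f : Module.Dual ℂ V) (x : V) :
    formEven π f x = 2⁻¹ * (f x + f (π x)) := by
  simp [formEven, mul_add]

theorem formOdd_apply (π : V →ₗ[ℂ] V) (f : Module.Dual ℂ V) (x : V) :
    formOdd π f x = 2⁻¹ * (f x - f (π x)) := by
  simp [formOdd]

theorem gradedPairing_tmul (π : V →ₗ[ℂ] V) (f g : Module.Dual ℂ V) (x y : V) :
    gradedPairing π (f ⊗ₜ g) (x ⊗ₜ y) = f x * formEven π g y + f (π x) * formOdd π g y := by
  simp [gradedPairing, koszul]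

theorem koszul_koszul {π : V →ₗ[ℂ] V} (hπ : ∀ x, π (π x) = x) (T) :
    koszul π (koszul π T) = T := by
  have h : koszul π ∘ₗ koszul π = LinearMap.id := by
    apply TensorProduct.ext'
    intro f g
    have e0 : formEven π (formEven π g) = formEven π g := by
      ext x; simp only [formEven_apply, hπ]; ring
    have e1 : formEven π (formOdd π g) = 0 := by
      ext x; simp only [formEven_apply, formOdd_apply, hπ, LinearMap.zero_apply]; ring
    have e2 : formOdd π (formEven π g) = 0 := by
      ext x; simp only [formEven_apply, formOdd_apply, hπ, LinearMap.zero_apply]; ring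
    have e3 : formOdd π (formOdd π g) = formOdd π g := by
      ext x; simp only [formOdd_apply, hπ]; ring
    have e4 : π.dualMap (π.dualMap f) = f := by ext x; simp [hπ]
    have e5 : formEven π g + formOdd π g = g := by
      ext x; simp only [LinearMap.add_apply, formEven_apply, formOdd_apply]; ring
    simp only [koszul, LinearMap.comp_apply, LinearMap.add_apply, TensorProduct.map_tmul,
      map_add, e0, e1, e2, e3, e4, LinearMap.id_apply, TensorProduct.tmul_zero, add_zero, zero_add]
    rw [← TensorProduct.tmul_add, e5]
  exact LinearMap.congr_fun h T

theorem dualDistrib_injective : Function.Injective (TensorProduct.dualDistrib ℂ V V) := by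
  rw [injective_iff_map_eq_zero]
  intro T hT
  let b := Module.Basis.ofVectorSpace ℂ (Module.Dual ℂ V)
  obtain ⟨c, rfl⟩ := TensorProduct.eq_repr_basis_left b T
  have hc : ∀ y : V, ∀ i, c i y = 0 := by
    intro y
    have hl := linearIndependent_iff'.mp b.linearIndependent c.support (fun i => c i y) (by
      ext x
      have := LinearMap.congr_fun hT (x ⊗ₜ y)
      simp only [Finsupp.sum, map_sum, LinearMap.sum_apply, TensorProduct.dualDistrib_apply,
        LinearMap.zero_apply] at this
      simpa [mul_comm] using this)
    intro i
    by_cases hi : i ∈ c.support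
    · exact hl i hi
    · rw [Finsupp.notMem_support_iff.mp hi]; rfl
  have : c = 0 := by
    ext i y; simpa using hc y i
  simp [this]

theorem gradedPairing_injective {π : V →ₗ[ℂ] V} (hπ : ∀ x, π (π x) = x) :
    Function.Injective (gradedPairing π) := by
  rw [gradedPairing, LinearMap.coe_comp]
  exact dualDistrib_injective.comp (Function.LeftInverse.injective (koszul_koszul hπ))

end Superspace

/-! ### Coproducts dual to a multiplication -/

section Coproduct

variable {B S : Type*} [Ring B] [Algebra ℂ B] [AddCommGroup S] [Module ℂ S]

/-- The space `S`, embedded by `j` into the dual of the superalgebra `B`, is closed under the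
coproduct dual to the multiplication of `B`: for every `s` there is `T ∈ S ⊗ S` with
`⟨T, x ⊗ y⟩ = ⟨s, x y⟩`. -/
def ComulClosed (π : B →ₗ[ℂ] B) (j : S →ₗ[ℂ] Module.Dual ℂ B) : Prop :=
  ∀ s, ∃ T : S ⊗[ℂ] S,
    gradedPairing π (TensorProduct.map j j T) = j s ∘ₗ LinearMap.mul' ℂ B

theorem pairing_map_injective {π : B →ₗ[ℂ] B} (hπ : ∀ x, π (π x) = x)
    {j : S →ₗ[ℂ] Module.Dual ℂ B} (hj : Function.Injective j) :
    Function.Injective (gradedPairing π ∘ₗ TensorProduct.map j j) := by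
  rw [LinearMap.coe_comp]
  exact (gradedPairing_injective hπ).comp
    (TensorProduct.map_injective_of_flat_flat j j hj hj)

/-- The coproduct `Δ : S → S ⊗ S` determined by `⟨Δ s, x ⊗ y⟩ = ⟨s, x y⟩`. -/
def comulOf (π : B →ₗ[ℂ] B) (hπ : ∀ x, π (π x) = x) (j : S →ₗ[ℂ] Module.Dual ℂ B)
    (hj : Function.Injective j) (h : ComulClosed π j) : S →ₗ[ℂ] S ⊗[ℂ] S :=
  (LinearEquiv.ofInjective _ (pairing_map_injective hπ hj)).symm.toLinearMap ∘ₗ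
    LinearMap.codRestrict (LinearMap.range (gradedPairing π ∘ₗ TensorProduct.map j j))
      ((LinearMap.mul' ℂ B).dualMap ∘ₗ j) (fun s => h s)

theorem comulOf_spec (π : B →ₗ[ℂ] B) (hπ : ∀ x, π (π x) = x) (j : S →ₗ[ℂ] Module.Dual ℂ B)
    (hj : Function.Injective j) (h : ComulClosed π j) (s : S) (x y : B) :
    gradedPairing π (TensorProduct.map j j (comulOf π hπ j hj h s)) (x ⊗ₜ y) = j s (x * y) := by
  have := congrArg Subtype.val ((LinearEquiv.ofInjective _ (pairing_map_injective hπ hj)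
    ).apply_symm_apply (LinearMap.codRestrict
      (LinearMap.range (gradedPairing π ∘ₗ TensorProduct.map j j))
      ((LinearMap.mul' ℂ B).dualMap ∘ₗ j) (fun s => h s) s))
  exact LinearMap.congr_fun this (x ⊗ₜ y)

end Coproduct

/-! ### The Lie superalgebra `sl(m|n)` -/

/-- The parity `[a]` of an index: `0` for `a ≤ m`, `1` for `a > m`. -/
def par {m n : ℕ} : Fin m ⊕ Fin n → ZMod 2 := Sum.elim (fun _ => 0) (fun _ => 1)

/-- The matrices of `gl(m|n)`. -/
abbrev Mat (m n : ℕ) := Matrix (Fin m ⊕ Fin n) (Fin m ⊕ Fin n) ℂ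

/-- `(-1) ^ p`. -/
def psign (p : ZMod 2) : ℂ := if p = 0 then 1 else -1

/-- The homogeneous component of `gl(m|n)` of degree `p`. -/
def Mat.part (m n : ℕ) (p : ZMod 2) : Submodule ℂ (Mat m n) where
  carrier := {x | ∀ a b, par a + par b ≠ p → x a b = 0}
  add_mem' hx hy a b h := by simp [hx a b h, hy a b h]
  zero_mem' _ _ _ := rfl
  smul_mem' c x hx a b h := by simp [hx a b h]

/-- The supertrace. -/
def str (m n : ℕ) : Mat m n →ₗ[ℂ] ℂ where
  toFun x := ∑ a, psign (par a) * x a a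
  map_add' x y := by simp [mul_add, Finset.sum_add_distrib]
  map_smul' c x := by
    simp only [Matrix.smul_apply, smul_eq_mul, RingHom.id_apply, Finset.mul_sum]
    exact Finset.sum_congr rfl fun a _ => by ring

/-- The superbracket `[x, y] = x y - (-1) ^ (p q) y x` of homogeneous matrices `x`, `y` of
degrees `p`, `q`. -/
def superBracket {m n : ℕ} (p q : ZMod 2) (x y : Mat m n) : Mat m n :=
  x * y - psign (p * q) • (y * x)

/-- `sl(m|n)`: the matrices with vanishing supertrace. -/
def sl (m n : ℕ) : Submodule ℂ (Mat m n) := LinearMap.ker (str m n)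

theorem zmod2 (p : ZMod 2) : p = 0 ∨ p = 1 := by
  revert p; decide

theorem psign_zero : psign 0 = 1 := by simp [psign]

theorem psign_one : psign 1 = -1 := by simp [psign]

theorem psign_mul_self (p : ZMod 2) : psign p * psign p = 1 := by
  rcases zmod2 p with rfl | rfl <;> simp [psign]

theorem psign_add (p q : ZMod 2) : psign (p + q) = psign p * psign q := by
  rcases zmod2 p with rfl | rfl <;> rcases zmod2 q with rfl | rfl <;>
    simp [psign, show (1 : ZMod 2) + 1 = 0 from rfl]

theorem superBracket_mem {m n : ℕ} {p q : ZMod 2} {x y : Mat m n}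
    (hx : x ∈ Mat.part m n p) (hy : y ∈ Mat.part m n q) : superBracket p q x y ∈ sl m n := by
  change str m n _ = 0
  have h : str m n (y * x) = ∑ a, ∑ b, psign (par b) * (y b a * x a b) := by
    rw [Finset.sum_comm]
    simp only [str, LinearMap.coe_mk, AddHom.coe_mk, Matrix.mul_apply, Finset.mul_sum]
  rw [superBracket, map_sub, map_smul, h, sub_eq_zero, smul_eq_mul, Finset.mul_sum]
  simp only [str, LinearMap.coe_mk, AddHom.coe_mk, Matrix.mul_apply, Finset.mul_sum]
  refine Finset.sum_congr rfl fun a _ => Finset.sum_congr rfl fun b _ => ?_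
  by_cases h1 : par a + par b = p
  · by_cases h2 : par b + par a = q
    · subst h1 h2
      rcases zmod2 (par a) with ha | ha <;> rcases zmod2 (par b) with hb | hb <;>
        rw [ha, hb] <;> simp [psign, show (1 : ZMod 2) + 1 = 0 from rfl, mul_comm]
    · rw [hy b a h2]; ring
  · rw [hx a b h1]; ring

/-! ### The enveloping superalgebra `U(sl(m|n))` -/

/-- The defining relations `x y = (-1) ^ (p q) y x + [x, y]` for homogeneous `x`, `y`. -/
inductive EnvRel (m n : ℕ) : TensorAlgebra ℂ (sl m n) → TensorAlgebra ℂ (sl m n) → Prop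
  | mk (p q : ZMod 2) (x y : sl m n) (hx : x.1 ∈ Mat.part m n p) (hy : y.1 ∈ Mat.part m n q) :
      EnvRel m n (TensorAlgebra.ι ℂ x * TensorAlgebra.ι ℂ y)
        (psign (p * q) • (TensorAlgebra.ι ℂ y * TensorAlgebra.ι ℂ x) +
          TensorAlgebra.ι ℂ ⟨superBracket p q x.1 y.1, superBracket_mem hx hy⟩)

/-- The enveloping algebra `U(sl(m|n))`. -/
def U (m n : ℕ) : Type := RingQuot (EnvRel m n)

instance (m n : ℕ) : Ring (U m n) := inferInstanceAs (Ring (RingQuot (EnvRel m n)))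

instance (m n : ℕ) : Algebra ℂ (U m n) := inferInstanceAs (Algebra ℂ (RingQuot (EnvRel m n)))

variable {m n : ℕ}

/-- The canonical map `sl(m|n) → U(sl(m|n))`. -/
def U.ι : sl m n →ₗ[ℂ] U m n :=
  (RingQuot.mkAlgHom ℂ (EnvRel m n)).toLinearMap ∘ₗ TensorAlgebra.ι ℂ

theorem U.rel {p q : ZMod 2} {x y : sl m n} (hx : x.1 ∈ Mat.part m n p)
    (hy : y.1 ∈ Mat.part m n q) :
    U.ι x * U.ι y = psign (p * q) • (U.ι y * U.ι x) +
      U.ι ⟨superBracket p q x.1 y.1, superBracket_mem hx hy⟩ := by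
  have := RingQuot.mkAlgHom_rel ℂ (EnvRel.mk p q x y hx hy)
  rw [map_mul, map_add, map_smul, map_mul] at this
  exact this

/-- The universal property of `U(sl(m|n))`. -/
def U.lift {C : Type*} [Ring C] [Algebra ℂ C] (φ : sl m n →ₗ[ℂ] C)
    (hφ : ∀ (p q : ZMod 2) (x y : sl m n) (hx : x.1 ∈ Mat.part m n p)
      (hy : y.1 ∈ Mat.part m n q), φ x * φ y = psign (p * q) • (φ y * φ x) +
        φ ⟨superBracket p q x.1 y.1, superBracket_mem hx hy⟩) : U m n →ₐ[ℂ] C :=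
  RingQuot.liftAlgHom ℂ ⟨TensorAlgebra.lift ℂ φ, by
    rintro _ _ ⟨p, q, x, y, hx, hy⟩
    simpa using hφ p q x y hx hy⟩

theorem U.lift_ι {C : Type*} [Ring C] [Algebra ℂ C] (φ : sl m n →ₗ[ℂ] C) (hφ) (x : sl m n) :
    U.lift φ hφ (U.ι x) = φ x := by
  exact (RingQuot.liftAlgHom_mkAlgHom_apply ℂ (TensorAlgebra.lift ℂ φ) _ _).trans (by simp)

theorem U.hom_ext {C : Type*} [Ring C] [Algebra ℂ C] {f g : U m n →ₐ[ℂ] C}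
    (h : ∀ x, f (U.ι x) = g (U.ι x)) : f = g := by
  apply RingQuot.ringQuot_ext' ℂ
  apply TensorAlgebra.hom_ext
  ext x
  exact h x

/-- The parity operator of `gl(m|n)`. -/
def matParity (m n : ℕ) : Mat m n →ₗ[ℂ] Mat m n where
  toFun x := Matrix.of fun a b => psign (par a + par b) * x a b
  map_add' x y := by ext a b; simp [mul_add]
  map_smul' c x := by ext a b; simp; ring

theorem matParity_of_mem {p : ZMod 2} {x : Mat m n} (hx : x ∈ Mat.part m n p) :
    matParity m n x = psign p • x := by
  ext a b
  by_cases h : par a + par b = p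
  · simp [matParity, h]
  · simp [matParity, hx a b h]

theorem add_self_zmod2 (p : ZMod 2) : p + p = 0 := by
  revert p; decide

theorem matParity_mem {x : Mat m n} (hx : x ∈ sl m n) : matParity m n x ∈ sl m n := by
  have : str m n (matParity m n x) = str m n x := by
    simp [str, matParity, add_self_zmod2, psign_zero]
  change str m n _ = 0
  rw [this]; exact hx

/-- The parity operator of `sl(m|n)`. -/
def slParity (m n : ℕ) : sl m n →ₗ[ℂ] sl m n :=
  (matParity m n).restrict fun _ hx => matParity_mem hx

theorem slParity_of_mem {p : ZMod 2} {x : sl m n} (hx : x.1 ∈ Mat.part m n p) :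
    slParity m n x = psign p • x :=
  Subtype.ext (matParity_of_mem hx)

theorem mul_mem_part {p q : ZMod 2} {x y : Mat m n} (hx : x ∈ Mat.part m n p)
    (hy : y ∈ Mat.part m n q) : x * y ∈ Mat.part m n (p + q) := by
  intro a b h
  rw [Matrix.mul_apply]
  refine Finset.sum_eq_zero fun c _ => ?_
  by_cases h1 : par a + par c = p
  · by_cases h2 : par c + par b = q
    · refine absurd ?_ h
      rw [← h1, ← h2]
      linear_combination - add_self_zmod2 (par c)
    · rw [hy _ _ h2, mul_zero]
  · rw [hx _ _ h1, zero_mul]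

theorem superBracket_mem_part {p q : ZMod 2} {x y : Mat m n} (hx : x ∈ Mat.part m n p)
    (hy : y ∈ Mat.part m n q) : superBracket p q x y ∈ Mat.part m n (p + q) :=
  sub_mem (mul_mem_part hx hy) (Submodule.smul_mem _ _ (add_comm p q ▸ mul_mem_part hy hx))

/-- The parity automorphism of `U(sl(m|n))`, induced by that of `sl(m|n)`. -/
def U.parity (m n : ℕ) : U m n →ₐ[ℂ] U m n :=
  U.lift (U.ι ∘ₗ slParity m n) (by
    intro p q x y hx hy
    simp only [LinearMap.comp_apply]
    rw [slParity_of_mem hx, slParity_of_mem hy, slParity_of_mem (p := p + q)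
      (superBracket_mem_part hx hy)]
    simp only [map_smul, smul_mul_smul_comm, U.rel hx hy, psign_add, smul_add]
    rw [smul_comm, mul_comm (psign q)])

theorem U.parity_ι {p : ZMod 2} {x : sl m n} (hx : x.1 ∈ Mat.part m n p) :
    U.parity m n (U.ι x) = psign p • U.ι x := by
  rw [U.parity, U.lift_ι, LinearMap.comp_apply, slParity_of_mem hx, map_smul]

theorem U.parity_parity (u : U m n) : U.parity m n (U.parity m n u) = u := by
  have : (U.parity m n).comp (U.parity m n) = AlgHom.id ℂ _ := by
    apply U.hom_ext
    intro x
    have h : ∀ x, slParity m n (slParity m n x) = x := by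
      intro x
      ext a b
      simp [slParity, matParity, ← mul_assoc, psign_mul_self]
    simp [U.parity, U.lift_ι, h]
  exact AlgHom.congr_fun this u

/-- The homogeneous component of `U(sl(m|n))` of degree `p`. -/
def U.part (m n : ℕ) (p : ZMod 2) : Submodule ℂ (U m n) where
  carrier := {u | U.parity m n u = psign p • u}
  add_mem' {x y} hx hy := by
    change U.parity m n _ = _ at *
    rw [map_add, hx, hy, smul_add]
  zero_mem' := by simp
  smul_mem' c x hx := by
    change U.parity m n _ = _ at *
    rw [map_smul, hx, smul_comm]

theorem U.mem_part {p : ZMod 2} {u : U m n} :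
    u ∈ U.part m n p ↔ U.parity m n u = psign p • u := Iff.rfl

/-- The component of degree `p` of an element. -/
def U.proj (p : ZMod 2) (u : U m n) : U.part m n p :=
  ⟨(2⁻¹ : ℂ) • (u + psign p • U.parity m n u), by
    rw [U.mem_part, map_smul, map_add, map_smul, U.parity_parity, smul_comm (psign p),
      smul_add (psign p), smul_smul (psign p) (psign p), psign_mul_self, one_smul, add_comm]⟩

theorem U.proj_add (u : U m n) : (U.proj 0 u : U m n) + (U.proj 1 u : U m n) = u := by
  simp only [U.proj, psign_zero, psign_one]
  module

instance U.gradedMonoid : SetLike.GradedMonoid (U.part m n) where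
  one_mem := by simp [U.mem_part, psign_zero]
  mul_mem p q x y hx hy := by
    rw [U.mem_part] at *
    rw [map_mul, hx, hy, smul_mul_smul_comm, psign_add]

open DirectSum in
instance U.gradedAlgebra : GradedAlgebra (U.part m n) where
  decompose' u := of (fun p => U.part m n p) 0 (U.proj 0 u) +
    of (fun p => U.part m n p) 1 (U.proj 1 u)
  left_inv u := by
    simp [U.proj_add]
  right_inv z := by
    induction z using DirectSum.induction_on with
    | zero =>
      have h : ∀ p, U.proj p (0 : U m n) = 0 := fun p => Subtype.ext (by simp [U.proj])
      simp [h]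
    | of p x =>
      have hx := U.mem_part.mp x.2
      have h : ∀ q, U.proj q x.1 = if h : p = q then h ▸ x else 0 := by
        intro q
        split_ifs with h
        · subst h
          apply Subtype.ext
          simp only [U.proj, hx, smul_smul, psign_mul_self]
          module
        · apply Subtype.ext
          simp only [U.proj, hx, smul_smul]
          rcases zmod2 p with rfl | rfl <;> rcases zmod2 q with rfl | rfl <;>
            simp [psign] at h ⊢
      rw [DirectSum.coeAddMonoidHom_of]
      beta_reduce
      rw [h, h]
      rcases zmod2 p with rfl | rfl <;> simp
    | add x y hx hy =>
      have h : ∀ p (a b : U m n), U.proj p (a + b) = U.proj p a + U.proj p b := fun p a b =>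
        Subtype.ext (by simp only [U.proj, map_add, Submodule.coe_add]; module)
      rw [map_add]
      beta_reduce
      rw [h, h, map_add, map_add]
      conv_rhs => rw [← hx, ← hy]
      exact add_add_add_comm _ _ _ _

/-! ### The Hopf structure of `U(sl(m|n))` -/

theorem units_smul {M : Type*} [AddCommGroup M] [Module ℂ M] (p : ZMod 2) (z : M) :
    ((-1 : ℤˣ) ^ p) • z = psign p • z := by
  rcases zmod2 p with rfl | rfl
  · simp [psign]
  · rw [uzpow_one]; simp [psign, Units.smul_def]

theorem U.mul_homog {q r : ZMod 2} {a b c d : U m n} (hb : b ∈ U.part m n q)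
    (hc : c ∈ U.part m n r) :
    ((a ᵍ⊗ₜ[ℂ] b) * (c ᵍ⊗ₜ[ℂ] d) : U.part m n ᵍ⊗[ℂ] U.part m n) =
      psign (q * r) • ((a * c) ᵍ⊗ₜ[ℂ] (b * d)) := by
  rw [← units_smul]
  exact GradedTensorProduct.tmul_coe_mul_coe_tmul _ _ a ⟨b, hb⟩ ⟨c, hc⟩ d

theorem U.ι_mem {p : ZMod 2} {x : sl m n} (hx : x.1 ∈ Mat.part m n p) :
    U.ι x ∈ U.part m n p := U.parity_ι hx

theorem U.one_mem : (1 : U m n) ∈ U.part m n 0 := SetLike.GradedOne.one_mem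

/-- The coproduct of `U(sl(m|n))`: the superalgebra map into the graded tensor product with
`Δ(x) = x ⊗ 1 + 1 ⊗ x` for `x ∈ sl(m|n)`. -/
def U.comulHom (m n : ℕ) : U m n →ₐ[ℂ] U.part m n ᵍ⊗[ℂ] U.part m n :=
  U.lift
    (((GradedTensorProduct.includeLeft (U.part m n) (U.part m n)).toLinearMap +
      (GradedTensorProduct.includeRight (U.part m n) (U.part m n)).toLinearMap) ∘ₗ U.ι) (by
    intro p q x y hx hy
    simp only [LinearMap.comp_apply, LinearMap.add_apply, AlgHom.toLinearMap_apply,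
      GradedTensorProduct.includeLeft_apply, GradedTensorProduct.includeRight_apply,
      add_mul, mul_add,
      U.mul_homog U.one_mem (U.ι_mem hx), U.mul_homog U.one_mem (U.ι_mem hy),
      U.mul_homog (U.ι_mem hx) (U.ι_mem hy), U.mul_homog (U.ι_mem hy) (U.ι_mem hx),
      U.mul_homog (U.ι_mem hx) U.one_mem, U.mul_homog (U.ι_mem hy) U.one_mem,
      U.mul_homog U.one_mem U.one_mem, mul_one, one_mul, mul_zero, zero_mul, psign_zero, one_smul,
      mul_comm q p]
    rw [U.rel hx hy]
    simp only [GradedTensorProduct.tmul, TensorProduct.add_tmul, TensorProduct.tmul_add, map_add,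
      TensorProduct.tmul_smul, ← TensorProduct.smul_tmul', map_smul, smul_add, smul_smul,
      psign_mul_self, one_smul]
    abel)

/-- The coproduct of `U(sl(m|n))` as a map to `U ⊗ U`. -/
def U.comul (m n : ℕ) : U m n →ₗ[ℂ] U m n ⊗[ℂ] U m n :=
  (GradedTensorProduct.of ℂ (U.part m n) (U.part m n)).symm.toLinearMap ∘ₗ
    (U.comulHom m n).toLinearMap

/-- The counit of `U(sl(m|n))`: `ε(x) = 0` for `x ∈ sl(m|n)`. -/
def U.counit (m n : ℕ) : U m n →ₐ[ℂ] ℂ := U.lift 0 (by simp)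

/-- `π` or the identity, according to the degree `p`. -/
def U.parityPow (p : ZMod 2) : U m n →ₗ[ℂ] U m n :=
  if p = 0 then LinearMap.id else (U.parity m n).toLinearMap

theorem U.parityPow_of_mem {p q : ZMod 2} {u : U m n} (hu : u ∈ U.part m n q) :
    U.parityPow p u = psign (p * q) • u := by
  rcases zmod2 p with rfl | rfl
  · simp [U.parityPow, psign_zero]
  · simpa [U.parityPow] using U.mem_part.mp hu

theorem U.mul_left_homog {q : ZMod 2} {a b c d : U m n} (hb : b ∈ U.part m n q) :
    ((a ᵍ⊗ₜ[ℂ] b) * (c ᵍ⊗ₜ[ℂ] d) : U.part m n ᵍ⊗[ℂ] U.part m n) =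
      (a * U.parityPow q c) ᵍ⊗ₜ[ℂ] (b * d) := by
  conv_lhs => rw [← U.proj_add c]
  conv_rhs => rw [← U.proj_add c]
  rw [map_add, U.parityPow_of_mem (U.proj 0 c).2, U.parityPow_of_mem (U.proj 1 c).2]
  simp only [GradedTensorProduct.tmul, TensorProduct.add_tmul, map_add, mul_add, mul_smul_comm,
    ← TensorProduct.smul_tmul', map_smul]
  rw [U.mul_homog hb (U.proj 0 c).2, U.mul_homog hb (U.proj 1 c).2]

theorem U.mul_right_homog {q : ZMod 2} {a b c d : U m n} (hc : c ∈ U.part m n q) :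
    ((a ᵍ⊗ₜ[ℂ] b) * (c ᵍ⊗ₜ[ℂ] d) : U.part m n ᵍ⊗[ℂ] U.part m n) =
      (a * c) ᵍ⊗ₜ[ℂ] (U.parityPow q b * d) := by
  conv_lhs => rw [← U.proj_add b]
  conv_rhs => rw [← U.proj_add b]
  rw [map_add, U.parityPow_of_mem (U.proj 0 b).2, U.parityPow_of_mem (U.proj 1 b).2]
  simp only [GradedTensorProduct.tmul, TensorProduct.tmul_add, map_add, add_mul, smul_mul_assoc,
    TensorProduct.tmul_smul, map_smul]
  rw [U.mul_homog (U.proj 0 b).2 hc, U.mul_homog (U.proj 1 b).2 hc, mul_comm q 0, mul_comm q 1]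

/-- Left multiplication by `Δ(x)`, `x ∈ sl(m|n)` of degree `p`. -/
theorem U.comul_ι_mul {p : ZMod 2} {x : sl m n} (hx : x.1 ∈ Mat.part m n p) (u : U m n) :
    U.comul m n (U.ι x * u) =
      TensorProduct.map (LinearMap.mulLeft ℂ (U.ι x)) LinearMap.id (U.comul m n u) +
      TensorProduct.map (U.parityPow p) (LinearMap.mulLeft ℂ (U.ι x)) (U.comul m n u) := by
  have key : ∀ w : U.part m n ᵍ⊗[ℂ] U.part m n,
      (GradedTensorProduct.of ℂ (U.part m n) (U.part m n)).symm (U.comulHom m n (U.ι x) * w) =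
      TensorProduct.map (LinearMap.mulLeft ℂ (U.ι x)) LinearMap.id
        ((GradedTensorProduct.of ℂ (U.part m n) (U.part m n)).symm w) +
      TensorProduct.map (U.parityPow p) (LinearMap.mulLeft ℂ (U.ι x))
        ((GradedTensorProduct.of ℂ (U.part m n) (U.part m n)).symm w) := by
    intro w
    obtain ⟨w, rfl⟩ := (GradedTensorProduct.of ℂ (U.part m n) (U.part m n)).surjective w
    rw [LinearEquiv.symm_apply_apply]
    induction w with
    | zero => simp
    | add a b ha hb => simp only [map_add, mul_add, ha, hb]; abel
    | tmul c d =>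
      have h0 := U.parityPow_of_mem (p := 0) (U.proj 0 c).2
      have e : U.comulHom m n (U.ι x) = (U.ι x ᵍ⊗ₜ[ℂ] 1) + (1 ᵍ⊗ₜ[ℂ] U.ι x) := by
        rw [U.comulHom, U.lift_ι]; simp
      rw [e, add_mul, map_add]
      erw [U.mul_left_homog U.one_mem, U.mul_left_homog (U.ι_mem hx)]
      simp [U.parityPow]
  have := key (U.comulHom m n u)
  rw [← map_mul] at this
  exact this

theorem U.comul_one : U.comul m n 1 = 1 ⊗ₜ 1 := by
  simp [U.comul, Algebra.TensorProduct.one_def]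

/-- `sl(m|n)` is spanned by homogeneous elements. -/
theorem sl_homog (x : sl m n) : ∃ y z : sl m n, y.1 ∈ Mat.part m n 0 ∧ z.1 ∈ Mat.part m n 1 ∧
    x = y + z := by
  refine ⟨(2⁻¹ : ℂ) • (x + slParity m n x), (2⁻¹ : ℂ) • (x - slParity m n x), ?_, ?_, by module⟩
  · intro a b h
    have : par a + par b = 1 := (zmod2 _).resolve_left h
    simp [slParity, matParity, this, psign_one]
  · intro a b h
    have : par a + par b = 0 := (zmod2 _).resolve_right h
    simp [slParity, matParity, this, psign_zero]

theorem U.induction {P : U m n → Prop} (h1 : P 1) (hadd : ∀ u v, P u → P v → P (u + v))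
    (hsmul : ∀ (c : ℂ) u, P u → P (c • u))
    (hι : ∀ (p : ZMod 2) (x : sl m n), x.1 ∈ Mat.part m n p → ∀ u, P u → P (U.ι x * u))
    (u : U m n) : P u := by
  have h0 : P 0 := by simpa using hsmul 0 _ h1
  let S : Subalgebra ℂ (U m n) :=
    { carrier := {v | ∀ u, P u → P (v * u)}
      mul_mem' := fun {a b} ha hb u hu => by rw [mul_assoc]; exact ha _ (hb _ hu)
      add_mem' := fun {a b} ha hb u hu => by rw [add_mul]; exact hadd _ _ (ha _ hu) (hb _ hu)
      algebraMap_mem' := fun r u hu => by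
        rw [← Algebra.smul_def]; exact hsmul _ _ hu }
  have hS : ∀ x : sl m n, U.ι x ∈ S := by
    intro x u hu
    obtain ⟨y, z, hy, hz, rfl⟩ := sl_homog x
    rw [map_add, add_mul]
    exact hadd _ _ (hι _ _ hy _ hu) (hι _ _ hz _ hu)
  let f : U m n →ₐ[ℂ] S := U.lift (LinearMap.codRestrict (Subalgebra.toSubmodule S) U.ι hS) (by
    intro p q x y hx hy
    apply Subtype.ext
    exact U.rel hx hy)
  have hf : S.val.comp f = AlgHom.id ℂ _ := by
    apply U.hom_ext
    intro x
    simp only [f, AlgHom.comp_apply, U.lift_ι]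
    rfl
  have : (S.val (f u)) = u := AlgHom.congr_fun hf u
  have hu : u ∈ S := this ▸ (f u).2
  simpa using hu 1 h1

/-! ### The superalgebra `U(sl(m|n))^*` of linear forms -/

/-- The parity operator of `U(sl(m|n))` as a linear map. -/
def U.π (m n : ℕ) : U m n →ₗ[ℂ] U m n := (U.parity m n).toLinearMap

theorem U.π_π (u : U m n) : U.π m n (U.π m n u) = u := U.parity_parity u

theorem dual_mul_ι {p : ZMod 2} {x : sl m n} (hx : x.1 ∈ Mat.part m n p)
    (f g : Module.Dual ℂ (U m n)) (u : U m n) :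
    formMul (U.π m n) (U.comul m n) f g (U.ι x * u) =
      formMul (U.π m n) (U.comul m n) (f ∘ₗ LinearMap.mulLeft ℂ (U.ι x))
        (g ∘ₗ U.parityPow p) u +
      formMul (U.π m n) (U.comul m n) f (g ∘ₗ LinearMap.mulLeft ℂ (U.ι x)) u := by
  simp only [formMul, LinearMap.comp_apply, U.comul_ι_mul hx, map_add]
  congr 1
  · induction U.comul m n u with
    | zero => simp
    | add a b ha hb => simp only [map_add, ha, hb]
    | tmul a b =>
      rw [TensorProduct.map_tmul, gradedPairing_tmul, gradedPairing_tmul]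
      rcases zmod2 p with rfl | rfl <;>
        simp [formEven_apply, formOdd_apply, U.π, U.parity_ι hx, psign, U.parityPow,
          U.parity_parity]
      ring
  · induction U.comul m n u with
    | zero => simp
    | add a b ha hb => simp only [map_add, ha, hb]
    | tmul a b =>
      rw [TensorProduct.map_tmul, gradedPairing_tmul, gradedPairing_tmul]
      rcases zmod2 p with rfl | rfl <;>
        simp [formEven_apply, formOdd_apply, U.π, U.parity_ι hx, psign, U.parityPow,
          U.parity_parity]
      ring

theorem dual_mul_one (f g : Module.Dual ℂ (U m n)) :
    formMul (U.π m n) (U.comul m n) f g 1 = f 1 * g 1 := by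
  rw [formMul, LinearMap.comp_apply, U.comul_one, gradedPairing_tmul]
  have h : U.π m n 1 = 1 := by simp [U.π]
  rw [formEven_apply, formOdd_apply, h]
  ring

theorem dual_mul_add (f g h : Module.Dual ℂ (U m n)) :
    formMul (U.π m n) (U.comul m n) f (g + h) =
      formMul (U.π m n) (U.comul m n) f g + formMul (U.π m n) (U.comul m n) f h := by
  simp only [formMul, TensorProduct.tmul_add, map_add, LinearMap.add_comp]

theorem dual_add_mul (f g h : Module.Dual ℂ (U m n)) :
    formMul (U.π m n) (U.comul m n) (f + g) h =
      formMul (U.π m n) (U.comul m n) f h + formMul (U.π m n) (U.comul m n) g h := by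
  simp only [formMul, TensorProduct.add_tmul, map_add, LinearMap.add_comp]

theorem dual_mul_smul (c : ℂ) (f g : Module.Dual ℂ (U m n)) :
    formMul (U.π m n) (U.comul m n) f (c • g) = c • formMul (U.π m n) (U.comul m n) f g := by
  simp only [formMul, TensorProduct.tmul_smul, map_smul, LinearMap.smul_comp]

theorem dual_smul_mul (c : ℂ) (f g : Module.Dual ℂ (U m n)) :
    formMul (U.π m n) (U.comul m n) (c • f) g = c • formMul (U.π m n) (U.comul m n) f g := by
  simp only [formMul, ← TensorProduct.smul_tmul', map_smul, LinearMap.smul_comp]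

theorem dual_mul_π (f g : Module.Dual ℂ (U m n)) :
    formMul (U.π m n) (U.comul m n) f g ∘ₗ U.π m n =
      formMul (U.π m n) (U.comul m n) (f ∘ₗ U.π m n) (g ∘ₗ U.π m n) := by
  ext u
  induction u using U.induction generalizing f g with
  | h1 =>
    have h : U.π m n 1 = 1 := by simp [U.π]
    simp [dual_mul_one, h]
  | hadd u v hu hv => simp only [map_add, hu, hv]
  | hsmul c u hu => simp only [map_smul, hu]
  | hι p x hx u hu =>
    have e : ∀ f : Module.Dual ℂ (U m n), (f ∘ₗ U.π m n) ∘ₗ LinearMap.mulLeft ℂ (U.ι x) =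
        psign p • ((f ∘ₗ LinearMap.mulLeft ℂ (U.ι x)) ∘ₗ U.π m n) := by
      intro f; ext v
      simp [U.π, U.parity_ι hx]
    have e2 : (g ∘ₗ U.π m n) ∘ₗ U.parityPow p = (g ∘ₗ U.parityPow p) ∘ₗ U.π m n := by
      rcases zmod2 p with rfl | rfl <;> (ext v; simp [U.parityPow, U.π])
    have e3 : U.π m n (U.ι x * u) = psign p • (U.ι x * U.π m n u) := by
      simp [U.π, U.parity_ι hx]
    rw [dual_mul_ι hx, e, e, e2, dual_smul_mul, dual_mul_smul, LinearMap.comp_apply, e3, map_smul,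
      dual_mul_ι hx, LinearMap.smul_apply, LinearMap.smul_apply, ← hu, ← hu]
    simp [mul_add]

theorem dual_mul_parityPow (p : ZMod 2) (f g : Module.Dual ℂ (U m n)) :
    formMul (U.π m n) (U.comul m n) f g ∘ₗ U.parityPow p =
      formMul (U.π m n) (U.comul m n) (f ∘ₗ U.parityPow p) (g ∘ₗ U.parityPow p) := by
  rcases zmod2 p with rfl | rfl
  · simp [U.parityPow]
  · exact dual_mul_π f g

theorem dual_mul_mulLeft {p : ZMod 2} {x : sl m n} (hx : x.1 ∈ Mat.part m n p)
    (f g : Module.Dual ℂ (U m n)) :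
    formMul (U.π m n) (U.comul m n) f g ∘ₗ LinearMap.mulLeft ℂ (U.ι x) =
      formMul (U.π m n) (U.comul m n) (f ∘ₗ LinearMap.mulLeft ℂ (U.ι x)) (g ∘ₗ U.parityPow p) +
      formMul (U.π m n) (U.comul m n) f (g ∘ₗ LinearMap.mulLeft ℂ (U.ι x)) := by
  ext u
  exact dual_mul_ι hx f g u

theorem dual_mul_assoc (f g h : Module.Dual ℂ (U m n)) :
    formMul (U.π m n) (U.comul m n) (formMul (U.π m n) (U.comul m n) f g) h =
      formMul (U.π m n) (U.comul m n) f (formMul (U.π m n) (U.comul m n) g h) := by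
  ext u
  induction u using U.induction generalizing f g h with
  | h1 => simp only [dual_mul_one, mul_assoc]
  | hadd u v hu hv => simp only [map_add, hu, hv]
  | hsmul c u hu => simp only [map_smul, hu]
  | hι p x hx u hu =>
    simp only [dual_mul_ι hx, dual_mul_mulLeft hx, dual_mul_parityPow, dual_add_mul, dual_mul_add,
      LinearMap.add_apply, hu, add_assoc]

theorem counit_mulLeft (x : sl m n) :
    (U.counit m n).toLinearMap ∘ₗ LinearMap.mulLeft ℂ (U.ι x) = 0 := by
  ext u; simp [U.counit, U.lift_ι]

theorem counit_parityPow (p : ZMod 2) :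
    (U.counit m n).toLinearMap ∘ₗ U.parityPow p = (U.counit m n).toLinearMap := by
  have h : (U.counit m n).comp (U.parity m n) = U.counit m n :=
    U.hom_ext fun x => by simp [U.counit, U.parity, U.lift_ι]
  rcases zmod2 p with rfl | rfl
  · simp [U.parityPow]
  · ext u
    simpa [U.parityPow] using AlgHom.congr_fun h u

theorem dual_one_mul (f : Module.Dual ℂ (U m n)) :
    formMul (U.π m n) (U.comul m n) (U.counit m n).toLinearMap f = f := by
  ext u
  induction u using U.induction generalizing f with
  | h1 => simp [dual_mul_one]
  | hadd u v hu hv => simp only [map_add, hu, hv]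
  | hsmul c u hu => simp only [map_smul, hu]
  | hι p x hx u hu =>
    rw [dual_mul_ι hx, counit_mulLeft, hu]
    simp [formMul]

theorem dual_mul_one' (f : Module.Dual ℂ (U m n)) :
    formMul (U.π m n) (U.comul m n) f (U.counit m n).toLinearMap = f := by
  ext u
  induction u using U.induction generalizing f with
  | h1 => simp [dual_mul_one]
  | hadd u v hu hv => simp only [map_add, hu, hv]
  | hsmul c u hu => simp only [map_smul, hu]
  | hι p x hx u hu =>
    rw [dual_mul_ι hx, counit_mulLeft, counit_parityPow, hu]
    simp [formMul]

/-- The algebra `U(sl(m|n))^*`: the product is `f g = (f ⊗ g) ∘ Δ`, the unit is the counit. -/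
instance dualRing (m n : ℕ) : Ring (Module.Dual ℂ (U m n)) :=
  { (inferInstance : AddCommGroup (Module.Dual ℂ (U m n))) with
    mul := formMul (U.π m n) (U.comul m n)
    one := (U.counit m n).toLinearMap
    left_distrib := dual_mul_add
    right_distrib := dual_add_mul
    zero_mul := fun f => by
      change formMul (U.π m n) (U.comul m n) 0 f = 0
      simp [formMul]
    mul_zero := fun f => by
      change formMul (U.π m n) (U.comul m n) f 0 = 0
      simp [formMul]
    mul_assoc := dual_mul_assoc
    one_mul := dual_one_mul
    mul_one := dual_mul_one' }

instance dualAlgebra (m n : ℕ) : Algebra ℂ (Module.Dual ℂ (U m n)) :=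
  Algebra.ofModule dual_smul_mul dual_mul_smul

theorem dual_mul_def (f g : Module.Dual ℂ (U m n)) :
    f * g = formMul (U.π m n) (U.comul m n) f g := rfl

theorem dual_one_def : (1 : Module.Dual ℂ (U m n)) = (U.counit m n).toLinearMap := rfl

/-! ### The vector representation, its dual, and the Hopf superalgebra `A` -/

/-- The vector representation `t` of `sl(m|n)`. -/
def vecRep (m n : ℕ) : U m n →ₐ[ℂ] Mat m n :=
  U.lift (sl m n).subtype (fun p q x y _ _ => by simp [superBracket])

/-- The negative of the supertranspose: `x ↦ x'`,
`x'_{ba} = - (-1) ^ ([a] ([a] + [b])) x_{ab}`. -/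
def negST (m n : ℕ) : Mat m n →ₗ[ℂ] Mat m n where
  toFun x := Matrix.of fun b a => -(psign (par a * (par a + par b)) * x a b)
  map_add' x y := by ext a b; simp [mul_add]; ring
  map_smul' c x := by ext a b; simp; ring

theorem negST_bracket {p q : ZMod 2} {x y : Mat m n} (hx : x ∈ Mat.part m n p)
    (hy : y ∈ Mat.part m n q) :
    negST m n x * negST m n y = psign (p * q) • (negST m n y * negST m n x) +
      negST m n (superBracket p q x y) := by
  have key : ∀ {p q : ZMod 2} {x y : Mat m n}, x ∈ Mat.part m n p → y ∈ Mat.part m n q →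
      negST m n x * negST m n y = -(psign (p * q) • negST m n (y * x)) := by
    intro p q x y hx hy
    ext b a
    simp only [negST, LinearMap.coe_mk, AddHom.coe_mk, Matrix.mul_apply, Matrix.of_apply,
      Matrix.neg_apply, Matrix.smul_apply, smul_eq_mul, mul_neg, neg_neg, Finset.mul_sum]
    refine Finset.sum_congr rfl fun c _ => ?_
    by_cases h1 : par c + par b = p
    · by_cases h2 : par a + par c = q
      · subst h1 h2
        rcases zmod2 (par a) with ha | ha <;> rcases zmod2 (par b) with hb | hb <;>
          rcases zmod2 (par c) with hc | hc <;>
          rw [ha, hb, hc] <;> simp [psign, show (1 : ZMod 2) + 1 = 0 from rfl, mul_comm]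
      · rw [hy _ _ h2]; ring
    · rw [hx _ _ h1]; ring
  rw [key hx hy, key hy hx, superBracket, map_sub, map_smul, smul_neg, smul_smul, mul_comm q p,
    psign_mul_self]
  module

/-- The dual vector representation `t̄`. With respect to the basis dual to the standard one, an
element `x` of `sl(m|n)` acts by `(x v)(w) = - (-1) ^ ([x] [v]) v(x w)`, i.e. by the matrix
`negST x`. -/
def dualRep (m n : ℕ) : U m n →ₐ[ℂ] Mat m n :=
  U.lift (negST m n ∘ₗ (sl m n).subtype) (fun _ _ _ _ hx hy => negST_bracket hx hy)

/-- The matrix elements `t_{ab}` as linear forms on `U(sl(m|n))`. -/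
def vecForm (a b : Fin m ⊕ Fin n) : Module.Dual ℂ (U m n) :=
  Matrix.entryLinearMap ℂ ℂ a b ∘ₗ (vecRep m n).toLinearMap

/-- The matrix elements `t̄_{ab}` as linear forms on `U(sl(m|n))`. -/
def dualForm (a b : Fin m ⊕ Fin n) : Module.Dual ℂ (U m n) :=
  Matrix.entryLinearMap ℂ ℂ a b ∘ₗ (dualRep m n).toLinearMap

/-- The superalgebra `A` of functions on `SL(m|n)`: the subalgebra of `U(sl(m|n))^*` generated by
the matrix elements of the vector representation and of its dual. -/
def A (m n : ℕ) : Subalgebra ℂ (Module.Dual ℂ (U m n)) :=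
  Algebra.adjoin ℂ
    (Set.range (fun ab : (Fin m ⊕ Fin n) × (Fin m ⊕ Fin n) => vecForm ab.1 ab.2) ∪
      Set.range (fun ab : (Fin m ⊕ Fin n) × (Fin m ⊕ Fin n) => dualForm ab.1 ab.2))

/-- `t_{ab}` as an element of `A`. -/
def t (a b : Fin m ⊕ Fin n) : A m n :=
  ⟨vecForm a b, Algebra.subset_adjoin (Or.inl ⟨(a, b), rfl⟩)⟩

/-- `t̄_{ab}` as an element of `A`. -/
def tbar (a b : Fin m ⊕ Fin n) : A m n :=
  ⟨dualForm a b, Algebra.subset_adjoin (Or.inr ⟨(a, b), rfl⟩)⟩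

theorem matParity_mul (x y : Mat m n) :
    matParity m n (x * y) = matParity m n x * matParity m n y := by
  ext a b
  simp only [matParity, LinearMap.coe_mk, AddHom.coe_mk, Matrix.mul_apply, Matrix.of_apply,
    Finset.mul_sum]
  refine Finset.sum_congr rfl fun c _ => ?_
  have : psign (par a + par b) = psign (par a + par c) * psign (par c + par b) := by
    rw [← psign_add]; congr 1; linear_combination - add_self_zmod2 (par c)
  rw [this]; ring

theorem matParity_one : matParity m n 1 = 1 := by
  ext a b
  by_cases h : a = b
  · subst h; simp [matParity, add_self_zmod2, psign_zero]
  · simp [matParity, h]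

/-- The parity operator of `gl(m|n)` as an algebra map. -/
def matParityHom (m n : ℕ) : Mat m n →ₐ[ℂ] Mat m n :=
  AlgHom.ofLinearMap (matParity m n) matParity_one matParity_mul

theorem U.parity_apply_ι (x : sl m n) : U.parity m n (U.ι x) = U.ι (slParity m n x) :=
  U.lift_ι _ _ x

theorem vecRep_ι (x : sl m n) : vecRep m n (U.ι x) = x.1 := U.lift_ι _ _ x

theorem dualRep_ι (x : sl m n) : dualRep m n (U.ι x) = negST m n x.1 := U.lift_ι _ _ x

theorem vecRep_parity (u : U m n) : vecRep m n (U.parity m n u) = matParity m n (vecRep m n u) := by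
  have : (vecRep m n).comp (U.parity m n) = (matParityHom m n).comp (vecRep m n) := by
    apply U.hom_ext
    intro x
    rw [AlgHom.comp_apply, AlgHom.comp_apply, U.parity_apply_ι, vecRep_ι, vecRep_ι]
    rfl
  exact AlgHom.congr_fun this u

theorem dualRep_parity (u : U m n) :
    dualRep m n (U.parity m n u) = matParity m n (dualRep m n u) := by
  have : (dualRep m n).comp (U.parity m n) = (matParityHom m n).comp (dualRep m n) := by
    apply U.hom_ext
    intro x
    rw [AlgHom.comp_apply, AlgHom.comp_apply, U.parity_apply_ι, dualRep_ι, dualRep_ι]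
    ext a b
    simp [slParity, negST, matParity, matParityHom, add_comm (par b) (par a)]
    ring
  exact AlgHom.congr_fun this u

theorem A_parity {f : Module.Dual ℂ (U m n)} (hf : f ∈ A m n) : f ∘ₗ U.π m n ∈ A m n := by
  induction hf using Algebra.adjoin_induction with
  | mem f hf =>
    rcases hf with ⟨⟨a, b⟩, rfl⟩ | ⟨⟨a, b⟩, rfl⟩
    · have : vecForm a b ∘ₗ U.π m n = psign (par a + par b) • vecForm a b := by
        ext u; simp [vecForm, U.π, vecRep_parity, matParity]
      change vecForm a b ∘ₗ U.π m n ∈ A m n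
      rw [this]; exact (A m n).smul_mem (t a b).2 _
    · have : dualForm a b ∘ₗ U.π m n = psign (par a + par b) • dualForm a b := by
        ext u; simp [dualForm, U.π, dualRep_parity, matParity]
      change dualForm a b ∘ₗ U.π m n ∈ A m n
      rw [this]; exact (A m n).smul_mem (tbar a b).2 _
  | algebraMap r =>
    rw [Algebra.algebraMap_eq_smul_one, LinearMap.smul_comp]
    have : (1 : Module.Dual ℂ (U m n)) ∘ₗ U.π m n = 1 := counit_parityPow (m := m) (n := n) 1
    rw [this]; exact (A m n).smul_mem (A m n).one_mem _
  | add f g _ _ hf hg => rw [LinearMap.add_comp]; exact (A m n).add_mem hf hg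
  | mul f g _ _ hf hg =>
    rw [dual_mul_def, dual_mul_π, ← dual_mul_def]; exact (A m n).mul_mem hf hg

/-- The parity operator of `A`: `⟨π a, x⟩ = ⟨a, π x⟩`. -/
def A.π (m n : ℕ) : A m n →ₗ[ℂ] A m n where
  toFun a := ⟨a.1 ∘ₗ U.π m n, A_parity a.2⟩
  map_add' _ _ := rfl
  map_smul' _ _ := rfl

theorem formEven_mem {f : Module.Dual ℂ (U m n)} (hf : f ∈ A m n) :
    formEven (U.π m n) f ∈ A m n :=
  (A m n).smul_mem ((A m n).add_mem hf (A_parity hf)) _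

theorem formOdd_mem {f : Module.Dual ℂ (U m n)} (hf : f ∈ A m n) :
    formOdd (U.π m n) f ∈ A m n :=
  (A m n).smul_mem ((A m n).sub_mem hf (A_parity hf)) _

/-- The compatibility of the product of forms with the multiplication of `U(sl(m|n))`. -/
theorem dual_mul_mul {ι κ : Type} [Fintype ι] [Fintype κ] {f g : Module.Dual ℂ (U m n)}
    {p q : ι → Module.Dual ℂ (U m n)} {p' q' : κ → Module.Dual ℂ (U m n)}
    (hf : ∀ x y, f (x * y) = ∑ i, p i x * q i y)
    (hg : ∀ x y, g (x * y) = ∑ i, p' i x * q' i y) (x y : U m n) :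
    (f * g) (x * y) = ∑ k : ι × κ,
      ((p k.1 * p' k.2) x * (q k.1 * formEven (U.π m n) (q' k.2)) y +
      ((p k.1 ∘ₗ U.π m n) * p' k.2) x * (q k.1 * formOdd (U.π m n) (q' k.2)) y) := by
  have key : ∀ s t : U m n ⊗[ℂ] U m n,
      gradedPairing (U.π m n) (f ⊗ₜ g) ((GradedTensorProduct.of ℂ (U.part m n) (U.part m n)).symm
        (GradedTensorProduct.of ℂ (U.part m n) (U.part m n) s *
          GradedTensorProduct.of ℂ (U.part m n) (U.part m n) t)) = ∑ k : ι × κ,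
      (gradedPairing (U.π m n) (p k.1 ⊗ₜ p' k.2) s *
        gradedPairing (U.π m n) (q k.1 ⊗ₜ formEven (U.π m n) (q' k.2)) t +
      gradedPairing (U.π m n) ((p k.1 ∘ₗ U.π m n) ⊗ₜ p' k.2) s *
        gradedPairing (U.π m n) (q k.1 ⊗ₜ formOdd (U.π m n) (q' k.2)) t) := by
    intro s t
    induction s with
    | zero => simp
    | add s s' h h' =>
      simp only [map_add, add_mul, h, h', ← Finset.sum_add_distrib]
      exact Finset.sum_congr rfl fun _ _ => by ring
    | tmul a b =>
    induction t with
    | zero => simp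
    | add s s' h h' =>
      simp only [map_add, mul_add, h, h', ← Finset.sum_add_distrib]
      exact Finset.sum_congr rfl fun _ _ => by ring
    | tmul c d =>
    have hom : ∀ (r : ZMod 2) (c : U m n), c ∈ U.part m n r →
        gradedPairing (U.π m n) (f ⊗ₜ g)
        ((GradedTensorProduct.of ℂ (U.part m n) (U.part m n)).symm
        ((a ᵍ⊗ₜ[ℂ] b) * (c ᵍ⊗ₜ[ℂ] d))) = ∑ k : ι × κ,
      (gradedPairing (U.π m n) (p k.1 ⊗ₜ p' k.2) (a ⊗ₜ b) *
        gradedPairing (U.π m n) (q k.1 ⊗ₜ formEven (U.π m n) (q' k.2)) (c ⊗ₜ d) +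
      gradedPairing (U.π m n) ((p k.1 ∘ₗ U.π m n) ⊗ₜ p' k.2) (a ⊗ₜ b) *
        gradedPairing (U.π m n) (q k.1 ⊗ₜ formOdd (U.π m n) (q' k.2)) (c ⊗ₜ d)) := by
      intro r c hc
      have hc' : U.π m n c = psign r • c := U.mem_part.mp hc
      have hm : ∀ u v, U.π m n (u * v) = U.π m n u * U.π m n v := fun u v => by simp [U.π]
      rw [U.mul_right_homog hc]
      simp only [GradedTensorProduct.tmul, LinearEquiv.symm_apply_apply, gradedPairing_tmul,
        formEven_apply, formOdd_apply, hm, hf, hg, hc', map_smul, LinearMap.comp_apply, U.π_π,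
        ← Finset.sum_add_distrib, ← Finset.sum_sub_distrib, Finset.mul_sum, Finset.sum_mul]
      rw [Finset.sum_comm, ← Finset.sum_product', Finset.univ_product_univ]
      refine Finset.sum_congr rfl fun k _ => ?_
      rcases zmod2 r with rfl | rfl
      · simp only [U.parityPow, psign, if_true, LinearMap.id_apply, one_smul]
        ring
      · have : U.parityPow (1 : ZMod 2) b = U.π m n b := by simp [U.parityPow, U.π]
        simp only [this, psign_one, U.π_π, smul_eq_mul]
        ring
    have h0 := hom 0 _ (U.proj 0 c).2
    have h1 := hom 1 _ (U.proj 1 c).2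
    have := congrArg₂ (· + ·) h0 h1
    beta_reduce at this
    rw [← map_add, ← map_add, ← mul_add, ← Finset.sum_add_distrib] at this
    simp only [GradedTensorProduct.tmul] at this
    rw [← map_add, ← TensorProduct.add_tmul, U.proj_add] at this
    rw [this]
    refine Finset.sum_congr rfl fun k _ => ?_
    conv_rhs => rw [← U.proj_add c]
    rw [TensorProduct.add_tmul, map_add, map_add]
    ring
  have := key (U.comul m n x) (U.comul m n y)
  simp only [dual_mul_def, formMul, LinearMap.comp_apply]
  rw [← this]
  congr 1
  simp [U.comul]

/-- Every element of `A` has a coproduct in `A ⊗ A`. -/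
theorem A_split {f : Module.Dual ℂ (U m n)} (hf : f ∈ A m n) :
    ∃ (ι : Type) (_ : Fintype ι) (p q : ι → Module.Dual ℂ (U m n)), (∀ i, p i ∈ A m n) ∧
      (∀ i, q i ∈ A m n) ∧ ∀ x y, f (x * y) = ∑ i, p i x * q i y := by
  induction hf using Algebra.adjoin_induction with
  | mem f hf =>
    rcases hf with ⟨⟨a, b⟩, rfl⟩ | ⟨⟨a, b⟩, rfl⟩
    · refine ⟨_, inferInstance, fun c => vecForm a c, fun c => vecForm c b, fun c => (t a c).2,
        fun c => (t c b).2, fun x y => ?_⟩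
      simp [vecForm, Matrix.mul_apply]
    · refine ⟨_, inferInstance, fun c => dualForm a c, fun c => dualForm c b,
        fun c => (tbar a c).2, fun c => (tbar c b).2, fun x y => ?_⟩
      simp [dualForm, Matrix.mul_apply]
  | algebraMap r =>
    refine ⟨Unit, inferInstance, fun _ => r • 1, fun _ => 1,
      fun _ => (A m n).smul_mem (A m n).one_mem _, fun _ => (A m n).one_mem, fun x y => ?_⟩
    rw [Algebra.algebraMap_eq_smul_one]
    simp [dual_one_def, mul_assoc]
  | add f g _ _ hf hg =>
    obtain ⟨ι, _, p, q, hp, hq, h⟩ := hf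
    obtain ⟨κ, _, p', q', hp', hq', h'⟩ := hg
    refine ⟨ι ⊕ κ, inferInstance, Sum.elim p p', Sum.elim q q', ?_, ?_, fun x y => ?_⟩
    · rintro (i | i)
      exacts [hp i, hp' i]
    · rintro (i | i)
      exacts [hq i, hq' i]
    · simp [h, h']
  | mul f g _ _ hf hg =>
    obtain ⟨ι, _, p, q, hp, hq, h⟩ := hf
    obtain ⟨κ, _, p', q', hp', hq', h'⟩ := hg
    refine ⟨(ι × κ) ⊕ (ι × κ), inferInstance,
      Sum.elim (fun k => p k.1 * p' k.2) (fun k => (p k.1 ∘ₗ U.π m n) * p' k.2),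
      Sum.elim (fun k => q k.1 * formEven (U.π m n) (q' k.2))
        (fun k => q k.1 * formOdd (U.π m n) (q' k.2)), ?_, ?_, fun x y => ?_⟩
    · rintro (k | k)
      exacts [(A m n).mul_mem (hp _) (hp' _), (A m n).mul_mem (A_parity (hp _)) (hp' _)]
    · rintro (k | k)
      exacts [(A m n).mul_mem (hq _) (formEven_mem (hq' _)),
        (A m n).mul_mem (hq _) (formOdd_mem (hq' _))]
    · rw [dual_mul_mul h h', Finset.sum_add_distrib]
      simp

theorem A_comulClosed (m n : ℕ) : ComulClosed (U.π m n) (A m n).val.toLinearMap := by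
  rintro ⟨f, hf⟩
  obtain ⟨ι, _, p, q, hp, hq, h⟩ := A_split hf
  refine ⟨∑ i, ((⟨p i, hp i⟩ : A m n) ⊗ₜ (⟨_, formEven_mem (hq i)⟩ : A m n) +
    (⟨_, A_parity (hp i)⟩ : A m n) ⊗ₜ (⟨_, formOdd_mem (hq i)⟩ : A m n)), ?_⟩
  have e : TensorProduct.map (A m n).val.toLinearMap (A m n).val.toLinearMap
      (∑ i, ((⟨p i, hp i⟩ : A m n) ⊗ₜ (⟨_, formEven_mem (hq i)⟩ : A m n) +
    (⟨_, A_parity (hp i)⟩ : A m n) ⊗ₜ (⟨_, formOdd_mem (hq i)⟩ : A m n))) =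
      koszul (U.π m n) (∑ i, p i ⊗ₜ q i) := by
    simp only [map_sum, map_add, TensorProduct.map_tmul]
    rfl
  rw [e, gradedPairing, LinearMap.comp_apply, koszul_koszul U.π_π]
  apply TensorProduct.ext'
  intro x y
  simpa using (h x y).symm

/-- The coproduct of `A`, determined by `⟨Δ a, x ⊗ y⟩ = ⟨a, x y⟩`. -/
def A.comul (m n : ℕ) : A m n →ₗ[ℂ] A m n ⊗[ℂ] A m n :=
  comulOf (U.π m n) U.π_π (A m n).val.toLinearMap Subtype.val_injective (A_comulClosed m n)

/-! ### The even part -/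

section Even

attribute [local instance 100] LieRing.ofAssociativeRing

/-- The even subalgebra `sl(m|n)_0` of `sl(m|n)`, a Lie algebra isomorphic to
`sl(m) ⊕ sl(n) ⊕ gl(1)` for `m, n ≥ 1`. -/
def slEven (m n : ℕ) : LieSubalgebra ℂ (Mat m n) where
  toSubmodule := Mat.part m n 0 ⊓ sl m n
  lie_mem' {x y} hx hy := by
    have e : ⁅x, y⁆ = superBracket 0 0 x y := by
      simp [superBracket, psign_zero, LieRing.of_associative_ring_bracket]
    rw [e]
    exact ⟨superBracket_mem_part hx.1 hy.1, superBracket_mem hx.1 hy.1⟩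

/-- The enveloping algebra of the even subalgebra. -/
abbrev Ue (m n : ℕ) : Type := UniversalEnvelopingAlgebra ℂ (slEven m n)

/-- The natural map `U(sl(m|n)_0) → U(sl(m|n))`. -/
def incl (m n : ℕ) : Ue m n →ₐ[ℂ] U m n :=
  UniversalEnvelopingAlgebra.lift ℂ
    { toFun := fun x => U.ι ⟨x.1, x.2.2⟩
      map_add' := fun x y => by rw [← map_add]; rfl
      map_smul' := fun c x => by rw [← map_smul]; rfl
      map_lie' := fun {x y} => by
        rw [LieRing.of_associative_ring_bracket,
          U.rel (p := 0) (q := 0) (x := ⟨x.1, x.2.2⟩) (y := ⟨y.1, y.2.2⟩) x.2.1 y.2.1]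
        simp [psign_zero, superBracket, LieRing.of_associative_ring_bracket] }

/-- The counit of `U(sl(m|n)_0)`. -/
def Ue.counit (m n : ℕ) : Ue m n →ₐ[ℂ] ℂ := UniversalEnvelopingAlgebra.lift ℂ 0

theorem counit_incl (m n : ℕ) :
    (U.counit m n).toLinearMap ∘ₗ (incl m n).toLinearMap = (Ue.counit m n).toLinearMap := by
  have : (U.counit m n).comp (incl m n) = Ue.counit m n := by
    apply UniversalEnvelopingAlgebra.hom_ext
    ext x
    simp only [LieHom.coe_comp, Function.comp_apply, AlgHom.coe_toLieHom, AlgHom.comp_apply,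
      incl, Ue.counit, UniversalEnvelopingAlgebra.lift_ι_apply]
    simp [U.counit, U.lift_ι]
  ext u
  exact AlgHom.congr_fun this u

end Even

/-- The restriction map `P` from linear forms on `U(sl(m|n))` to linear forms on
`U(sl(m|n)_0)`. -/
def restr (m n : ℕ) : Module.Dual ℂ (U m n) →ₗ[ℂ] Module.Dual ℂ (Ue m n) :=
  (incl m n).toLinearMap.dualMap

/-- The space `A_e = P(A)`. -/
def Ae (m n : ℕ) : Submodule ℂ (Module.Dual ℂ (Ue m n)) :=
  (Subalgebra.toSubmodule (A m n)).map (restr m n)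

/-- The map `P : A → A_e`. -/
def P (m n : ℕ) : A m n →ₗ[ℂ] Ae m n :=
  LinearMap.codRestrict _ (restr m n ∘ₗ (A m n).val.toLinearMap) fun a => ⟨a.1, a.2, rfl⟩

/-- The unit element of `A_e`, i.e. the counit of `U(sl(m|n)_0)`. -/
def Ae.one (m n : ℕ) : Ae m n :=
  ⟨(Ue.counit m n).toLinearMap, 1, (A m n).one_mem, counit_incl m n⟩

theorem koszul_id {V : Type*} [AddCommGroup V] [Module ℂ V] :
    koszul (LinearMap.id : V →ₗ[ℂ] V) = LinearMap.id := by
  apply TensorProduct.ext'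
  intro f g
  have e1 : formEven LinearMap.id g = g := by
    ext x; rw [formEven_apply]; simp; ring
  have e2 : formOdd LinearMap.id g = 0 := by
    ext x; rw [formOdd_apply]; simp
  simp [koszul, e1, e2]

theorem Ae_comulClosed (m n : ℕ) :
    ComulClosed (LinearMap.id : Ue m n →ₗ[ℂ] Ue m n) (Ae m n).subtype := by
  rintro ⟨_, f, hf, rfl⟩
  obtain ⟨ι, _, p, q, hp, hq, h⟩ := A_split hf
  refine ⟨∑ i, (P m n ⟨p i, hp i⟩ ⊗ₜ P m n ⟨q i, hq i⟩), ?_⟩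
  rw [gradedPairing, koszul_id]
  apply TensorProduct.ext'
  intro x y
  simp [restr, P, h]

/-- The coproduct of `A_e`, determined by `⟨Δ a, x ⊗ y⟩ = ⟨a, x y⟩`. (All elements of
`U(sl(m|n)_0)` are even.) -/
def Ae.comul (m n : ℕ) : Ae m n →ₗ[ℂ] Ae m n ⊗[ℂ] Ae m n :=
  comulOf LinearMap.id (fun _ => rfl) (Ae m n).subtype Subtype.val_injective (Ae_comulClosed m n)

/-- `I₀` is a left integral on `A_e` with `I₀(1) = 1`. -/
def IsNormalizedIntegral (m n : ℕ) (I₀ : Module.Dual ℂ (Ae m n)) : Prop :=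
  IsLeftIntegral LinearMap.id (Ae.comul m n) (Ae.one m n) I₀ ∧ I₀ (Ae.one m n) = 1

/-! ### The integral on `A` -/

/-- The embedding `ν : U(sl(m|n)) → A^*`, `⟨ν(x), a⟩ = (-1) ^ ([x] [a]) ⟨a, x⟩`. (The sign may be
written `(-1) ^ [x]`, since `⟨a, x⟩ = 0` unless `[a] = [x]`.) -/
def ν (m n : ℕ) (x : U m n) : Module.Dual ℂ (A m n) where
  toFun a := a.1 (U.π m n x)
  map_add' _ _ := rfl
  map_smul' _ _ := rfl

/-- A matrix unit `E_{ab}`, `a ≠ b`, in `U(sl(m|n))`. -/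
def E (a b : Fin m ⊕ Fin n) (h : a ≠ b) : U m n :=
  U.ι ⟨Matrix.single a b 1, by
    change ∑ c, psign (par c) * Matrix.single a b (1 : ℂ) c c = 0
    refine Finset.sum_eq_zero fun c _ => ?_
    rw [Matrix.single_apply, if_neg, mul_zero]
    rintro ⟨rfl, rfl⟩
    exact h rfl⟩

/-- `𝔼_i = E_{i,m+1} E_{i,m+2} ⋯ E_{i,m+n}`. -/
def EE_row (m n : ℕ) (i : Fin m) : U m n :=
  (List.ofFn fun μ : Fin n => E (.inl i) (.inr μ) Sum.inl_ne_inr).prod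

/-- `𝔼 = 𝔼_m 𝔼_{m-1} ⋯ 𝔼_1`. -/
def EE (m n : ℕ) : U m n := (List.ofFn fun i : Fin m => EE_row m n i).reverse.prod

/-- `𝔽_i = E_{m+n,i} E_{m+n-1,i} ⋯ E_{m+1,i}`. -/
def FF_row (m n : ℕ) (i : Fin m) : U m n :=
  (List.ofFn fun μ : Fin n => E (.inr μ) (.inl i) Sum.inr_ne_inl).reverse.prod

/-- `𝔽 = 𝔽_1 𝔽_2 ⋯ 𝔽_m`. -/
def FF (m n : ℕ) : U m n := (List.ofFn fun i : Fin m => FF_row m n i).prod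

/-- `Γ = 𝔼 𝔽`. -/
def Γ (m n : ℕ) : U m n := EE m n * FF m n

/-- `Θ_i = t_{i,m+n} t_{i,m+n-1} ⋯ t_{i,m+1}`. -/
def Θ_row (m n : ℕ) (i : Fin m) : A m n :=
  (List.ofFn fun μ : Fin n => t (.inl i) (.inr μ)).reverse.prod

/-- `Θ = Θ_m Θ_{m-1} ⋯ Θ_1`. -/
def Θ (m n : ℕ) : A m n := (List.ofFn fun i : Fin m => Θ_row m n i).reverse.prod

/-- `Θ̄_i = t̄_{i,m+n} t̄_{i,m+n-1} ⋯ t̄_{i,m+1}`. -/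
def Θbar_row (m n : ℕ) (i : Fin m) : A m n :=
  (List.ofFn fun μ : Fin n => tbar (.inl i) (.inr μ)).reverse.prod

/-- `Θ̄ = Θ̄_m Θ̄_{m-1} ⋯ Θ̄_1`. -/
def Θbar (m n : ℕ) : A m n := (List.ofFn fun i : Fin m => Θbar_row m n i).reverse.prod

/-- The linear form `ν(Γ) · (I₀ ∘ P)` on `A`, the product being that of `A^*`. -/
def superIntegral (m n : ℕ) (I₀ : Module.Dual ℂ (Ae m n)) : Module.Dual ℂ (A m n) :=
  formMul (A.π m n) (A.comul m n) (ν m n (Γ m n)) (I₀ ∘ₗ P m n)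

end SuperInt
end

/-! The integral on `A` is `a ↦ I₀ (a(Γ ·))`, where `I₀` is the integral of the even part, applied
after restriction to `U(𝔤₀)`. Everything is expressed by translations: a form on `A` (or on `A_e`)
is a left integral if and only if it kills all left translates `a(x ·)` with `x` in the Lie
(super)algebra, and a right integral if and only if it kills the right translates `a(· x)`.

*The even part.* Every element of `A` lies in a finite-dimensional space of forms on which the
even part acts by left translations through a quotient of a unitary representation: such spaces
are closed under sums and products, and the matrix elements of the vector representation and of its
dual span spaces of this kind (`exists_isUnitarySpace`). Orthogonal decomposition shows that `A_e`
is the direct sum of the line of the counit and of the span of the translates `a(x ·)`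
(`counit_notMem`, `exists_sub_mem_translatesE`); the projection to that line is the unique
normalized integral `I₀`. As right translations commute with left ones, `I₀` is also right
invariant.

*Invariance.* In the enveloping algebra `x Γ ∈ U 𝔤₀` and `Γ x ∈ 𝔤₀ U` for all `x` in `sl(m|n)`, and
`Γ` commutes with `𝔤₀` (`ι_mul_Γ_mem`, `op_Γ_mul_ι_mem`, `ι_mul_Γ`). The first relation and the left
invariance of `I₀` give the left invariance of the integral. Since `Γ` commutes with `U(𝔤₀)`, the
integral is also `a ↦ I₀ (a(· Γ))`, and the second relation gives the right invariance. The
relations follow from manipulations with anticommuting products that are symmetric under reversing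
the multiplication and exchanging `𝔼` with `𝔽` (`OddPair.mul_mem`, `OddPair.op`).

*The value on `Θ Θ̄`.* The even part multiplies `Θ` and `Θ̄` by opposite traces, so `Θ Θ̄` is
invariant under left translations by `𝔤₀`, and the restriction of `(Θ Θ̄)(Γ ·)` to `U(𝔤₀)` is a
multiple of the counit. The multiple is `(Θ Θ̄)(𝔼 𝔽)`, which reduces to `± Θ(𝔼) Θ̄(𝔽)`. In
both factors odd forms are evaluated on a dual family of odd elements, as in an exterior algebra.
The order of the factors of `𝔽` is opposite to that of `𝔼`, whereas `Θ` and `Θ̄` have the same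
order; hence the reordering signs cancel and only the sign of reversal remains. -/

noncomputable section

namespace SuperInt


/-! ### Products of anticommuting families -/

section Anticommuting

variable {R ι : Type*} [Ring R] [Algebra ℂ R]

/-- A family of pairwise anticommuting elements. Indices may coincide, so that (the ring being a
`ℂ`-algebra) all the elements have square zero. -/
def AntiComm (e : ι → R) : Prop := ∀ p q, e p * e q = -(e q * e p)

variable {e : ι → R}

theorem AntiComm.mul_self (he : AntiComm e) (p : ι) : e p * e p = 0 := by
  have h := he p p
  have h2 : (2 : ℂ) • (e p * e p) = 0 := by
    rw [two_smul]
    nth_rewrite 1 [h]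
    exact neg_add_cancel _
  simpa using h2

theorem AntiComm.mul_prod (he : AntiComm e) (p : ι) (l : List ι) :
    e p * (l.map e).prod = (-1 : ℂ) ^ l.length • ((l.map e).prod * e p) := by
  induction l with
  | nil => simp
  | cons q l ih =>
    rw [List.map_cons, List.prod_cons, ← mul_assoc, he p q, neg_mul, mul_assoc, ih,
      List.length_cons, pow_succ]
    simp [mul_assoc]

theorem AntiComm.mul_prod_of_mem (he : AntiComm e) {p : ι} {l : List ι} (hp : p ∈ l) :
    e p * (l.map e).prod = 0 := by
  induction l with
  | nil => simp at hp
  | cons q l ih =>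
    rw [List.map_cons, List.prod_cons, ← mul_assoc]
    rcases List.mem_cons.mp hp with rfl | hp
    · rw [he.mul_self, zero_mul]
    · rw [he p q, neg_mul, mul_assoc, ih hp, mul_zero, neg_zero]

theorem AntiComm.prod_mul_of_mem (he : AntiComm e) {p : ι} {l : List ι} (hp : p ∈ l) :
    (l.map e).prod * e p = 0 := by
  have h := he.mul_prod p l
  rw [he.mul_prod_of_mem hp] at h
  simpa using h.symm

/-- Reordering a product of anticommuting elements produces a sign that depends only on the two
orderings. -/
theorem exists_sign_of_perm.{u} {ι : Type*} {l l' : List ι} (h : l.Perm l') :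
    ∃ s : ℂ, s * s = 1 ∧ ∀ (R : Type u) [Ring R] [Algebra ℂ R] (e : ι → R), AntiComm e →
      (l.map e).prod = s • (l'.map e).prod := by
  induction h with
  | nil => exact ⟨1, by simp, by simp⟩
  | cons x _ ih =>
    obtain ⟨s, hs, h⟩ := ih
    exact ⟨s, hs, fun R _ _ e he => by simp [h R e he]⟩
  | swap x y l =>
    refine ⟨-1, by simp, fun R _ _ e he => ?_⟩
    simp only [List.map_cons, List.prod_cons, ← mul_assoc]
    rw [he y x]
    simp
  | trans _ _ ih ih' =>
    obtain ⟨s, hs, h⟩ := ih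
    obtain ⟨s', hs', h'⟩ := ih'
    refine ⟨s * s', by linear_combination s' * s' * hs + hs', fun R _ _ e he => ?_⟩
    rw [h R e he, h' R e he, smul_smul]

/-- A derivation `D` that acts linearly on the span of an anticommuting family multiplies the
product of the family by a trace. The prefix `l₁` allows for contributions outside `l₂`: they
vanish as soon as they repeat a factor of the prefix. -/
theorem AntiComm.deriv_prod [Fintype ι] [DecidableEq ι] (he : AntiComm e) (D : R →ₗ[ℂ] R)
    (hD : ∀ a b, D (a * b) = D a * b + a * D b) (X : ι → ι → ℂ) (l₁ l₂ : List ι)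
    (hDe : ∀ r ∈ l₂, D (e r) = ∑ s, X s r • e s)
    (hX : ∀ r ∈ l₂, ∀ s, s ∉ l₁ → s ∉ l₂ → X s r = 0) (hl : (l₁ ++ l₂).Nodup) :
    (l₁.map e).prod * D (l₂.map e).prod =
      (l₂.map fun r => X r r).sum • ((l₁.map e).prod * (l₂.map e).prod) := by
  induction l₂ generalizing l₁ with
  | nil =>
    have h := hD 1 1
    simp only [mul_one, one_mul, left_eq_add] at h
    simp [h]
  | cons r l ih =>
    have h1 := ih (l₁ ++ [r]) (fun q hq => hDe q (by simp [hq]))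
      (fun q hq s hs hs' => hX q (by simp [hq]) s (by simp_all) (by simp_all)) (by simpa using hl)
    have h2 : (l₁.map e).prod * (D (e r) * (l.map e).prod) =
        X r r • ((l₁.map e).prod * (e r * (l.map e).prod)) := by
      rw [hDe r (by simp), Finset.sum_mul, Finset.mul_sum, Finset.sum_eq_single r]
      · simp
      · intro s _ hs
        by_cases h1 : s ∈ l₁
        · rw [smul_mul_assoc, mul_smul_comm, ← mul_assoc, he.prod_mul_of_mem h1]
          simp
        · by_cases h2 : s ∈ l
          · rw [smul_mul_assoc, mul_smul_comm, he.mul_prod_of_mem h2]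
            simp
          · rw [hX r (by simp) s h1 (by simp [hs, h2])]
            simp
      · simp
    simp only [List.map_append, List.prod_append, List.map_cons, List.map_nil, List.prod_cons,
      List.prod_nil, mul_one, mul_assoc] at h1
    rw [List.map_cons, List.prod_cons, hD, mul_add, h2, h1]
    simp [add_smul]

theorem AntiComm.deriv_prod_full [Fintype ι] [DecidableEq ι] (he : AntiComm e) (D : R →ₗ[ℂ] R)
    (hD : ∀ a b, D (a * b) = D a * b + a * D b) (X : ι → ι → ℂ) (l : List ι)
    (hDe : ∀ r, D (e r) = ∑ s, X s r • e s) (hl : l.Nodup) (hl' : ∀ p, p ∈ l) :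
    D (l.map e).prod = (∑ r, X r r) • (l.map e).prod := by
  have h := he.deriv_prod D hD X [] l (fun r _ => hDe r) (fun _ _ s _ h => absurd (hl' s) h)
    (by simpa using hl)
  have hs : (l.map fun r => X r r).sum = ∑ r, X r r := by
    rw [← List.sum_toFinset _ hl]
    congr 1
    ext p
    simp [hl' p]
  simpa [hs] using h

end Anticommuting

/-! ### The two odd parts of an algebra with even brackets -/

section OddPair

variable {R ι : Type*} [Ring R] [Algebra ℂ R]

/-- The commutator with `b`, as a linear map. -/
def commMap (b : R) : R →ₗ[ℂ] R := LinearMap.mulLeft ℂ b - LinearMap.mulRight ℂ b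

theorem commMap_apply (b x : R) : commMap b x = b * x - x * b := rfl

theorem commMap_mul (b x y : R) : commMap b (x * y) = commMap b x * y + x * commMap b y := by
  simp only [commMap_apply]
  noncomm_ring

/-- Two anticommuting families `e`, `f` (bases of the odd parts `𝔤₊` and `𝔤₋`) whose mutual
anticommutators `B p q = {f p, e q}` act linearly on both of them, with matrices `X p q` on `e`
and `Y p q` on `f`. The remaining conditions hold for the odd generators of `gl(m|n)`: for `p ≠ q`
the matrices have zero diagonal, and do not map other basis vectors to `p` or `q`; for `p = q`
their row `p` vanishes, and their traces cancel. -/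
structure OddPair [Fintype ι] (e f : ι → R) (B : ι → ι → R) (X Y : ι → ι → ι → ι → ℂ) : Prop where
  e_anti : AntiComm e
  f_anti : AntiComm f
  fe : ∀ p q, f p * e q + e q * f p = B p q
  comm_e : ∀ p q r, B p q * e r - e r * B p q = ∑ s, X p q s r • e s
  comm_f : ∀ p q r, B p q * f r - f r * B p q = ∑ s, Y p q s r • f s
  diag_X : ∀ p q r, p ≠ q → X p q r r = 0
  diag_Y : ∀ p q r, p ≠ q → Y p q r r = 0
  self_X : ∀ p, X p p p p = 0
  self_Y : ∀ p, Y p p p p = 0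
  trace : ∀ p, ∑ r, X p p r r + ∑ r, Y p p r r = 0
  fst_X : ∀ p q r, r ≠ p → r ≠ q → X p q p r = 0
  snd_X : ∀ p q r, r ≠ p → r ≠ q → X p q q r = 0
  fst_Y : ∀ p q r, r ≠ p → r ≠ q → Y p q p r = 0
  snd_Y : ∀ p q r, r ≠ p → r ≠ q → Y p q q r = 0

variable [Fintype ι] {e f : ι → R} {B : ι → ι → R} {X Y : ι → ι → ι → ι → ℂ}

open MulOpposite in
/-- Reversing the multiplication exchanges the roles of `e` and `f`. -/
theorem OddPair.op (h : OddPair e f B X Y) :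
    OddPair (fun p => op (f p)) (fun p => op (e p)) (fun p q => op (B q p))
      (fun p q s r => -Y q p s r) (fun p q s r => -X q p s r) where
  e_anti p q := by rw [← op_mul, ← op_mul, h.f_anti q p, op_neg]
  f_anti p q := by rw [← op_mul, ← op_mul, h.e_anti q p, op_neg]
  fe p q := by rw [← op_mul, ← op_mul, ← op_add, h.fe]
  comm_e p q r := by
    rw [← op_mul, ← op_mul, ← op_sub, ← neg_sub, h.comm_f, ← Finset.sum_neg_distrib,
      Finset.op_sum]
    simp
  comm_f p q r := by
    rw [← op_mul, ← op_mul, ← op_sub, ← neg_sub, h.comm_e, ← Finset.sum_neg_distrib,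
      Finset.op_sum]
    simp
  diag_X p q r hpq := by simp [h.diag_Y q p r hpq.symm]
  diag_Y p q r hpq := by simp [h.diag_X q p r hpq.symm]
  self_X p := by simp [h.self_Y]
  self_Y p := by simp [h.self_X]
  trace p := by
    have := h.trace p
    simp only [Finset.sum_neg_distrib]
    linear_combination -this
  fst_X p q r h1 h2 := by simp [h.snd_Y q p r h2 h1]
  snd_X p q r h1 h2 := by simp [h.fst_Y q p r h2 h1]
  fst_Y p q r h1 h2 := by simp [h.snd_X q p r h2 h1]
  snd_Y p q r h1 h2 := by simp [h.fst_X q p r h2 h1]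

/-- `f p` maps the product of all `e` and all `f` into the left ideal generated by the
brackets. Writing `∏ e = ± e p * E'`, one has
`f p * e p * E' = B p p * E' - e p * f p * E'`. The first term is in the ideal because `B p p` has
total weight zero on `E' * ∏ f`. In the second one `f p` is moved through `E'`; this only produces
brackets `B p q` with `q ≠ p`, which commute with what follows up to repeated factors. -/
theorem OddPair.mul_mem [DecidableEq ι] (h : OddPair e f B X Y) (p : ι) {l l' : List ι}
    (hl : l.Nodup) (hl1 : ∀ p, p ∈ l) (hl' : l'.Nodup) (hl1' : ∀ p, p ∈ l') :
    f p * ((l.map e).prod * (l'.map f).prod) ∈ Ideal.span {b | ∃ p q, b = B p q} := by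
  set I := Ideal.span {b | ∃ p q, b = B p q}
  have hB : ∀ p q z, z * B p q ∈ I := fun p q z =>
    I.mul_mem_left _ (Ideal.subset_span ⟨p, q, rfl⟩)
  set F := (l'.map f).prod with hF
  have hBF : ∀ q, B p q * F = F * B p q + (∑ r, Y p q r r) • F := by
    intro q
    have := h.f_anti.deriv_prod_full (commMap (B p q)) (commMap_mul _) (Y p q) l'
      (h.comm_f p q) hl' hl1'
    rw [commMap_apply, ← hF] at this
    rw [← this]; abel
  -- moving `f p` through a product of `e q` with `q ≠ p`
  have key : ∀ l₂ l₁ : List ι, (l₁ ++ l₂).Nodup → (∀ q, q ≠ p ↔ q ∈ l₁ ++ l₂) →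
      (l₁.map e).prod * (f p * ((l₂.map e).prod * F)) ∈ I := by
    intro l₂
    induction l₂ with
    | nil =>
      intro l₁ _ _
      rw [List.map_nil, List.prod_nil, one_mul, h.f_anti.mul_prod_of_mem (hl1' p), mul_zero]
      exact I.zero_mem
    | cons q l₂ ih =>
      intro l₁ hn hm
      have h1 := ih (l₁ ++ [q]) (by simpa using hn) (by simpa using hm)
      have hpq : p ≠ q := by
        rintro rfl
        exact (hm p).mpr (by simp) rfl
      have hn' : (l₁ ++ l₂).Nodup := hn.sublist (by simp)
      have hq : q ∉ l₁ ∧ q ∉ l₂ := by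
        simp only [List.nodup_append, List.nodup_cons, List.mem_cons] at hn
        exact ⟨fun hq => hn.2.2 q hq q (Or.inl rfl) rfl, hn.2.1.1⟩
      have h2 := h.e_anti.deriv_prod (commMap (B p q)) (commMap_mul _) (X p q) l₁ l₂
        (fun r _ => h.comm_e p q r) (fun r hr s hs hs' => by
          have hr1 : r ≠ q := fun hh => hq.2 (hh ▸ hr)
          have hr2 : r ≠ p := (hm r).mpr (by simp [hr])
          by_cases hsq : s = q
          · subst hsq; exact h.snd_X p s r hr2 hr1
          · have : s = p := by
              by_contra hsp
              have := (hm s).mp hsp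
              simp [hs, hs', hsq] at this
            subst this; exact h.fst_X s q r hr2 hr1) hn'
      have h3 : (l₂.map fun r => X p q r r) = l₂.map fun _ => (0 : ℂ) :=
        List.map_congr_left fun r _ => h.diag_X p q r hpq
      have hBF' : B p q * F = F * B p q := by
        rw [hBF, Finset.sum_eq_zero fun r _ => h.diag_Y p q r hpq]; simp
      rw [h3, commMap_apply] at h2
      simp only [List.map_const', List.sum_replicate, smul_zero, zero_smul, mul_sub,
        sub_eq_zero] at h2
      simp only [List.map_append, List.prod_append, List.map_cons, List.map_nil, List.prod_cons,
        List.prod_nil, mul_one] at h1 ⊢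
      have e1 : (l₁.map e).prod * (f p * (e q * (l₂.map e).prod * F)) =
          (l₁.map e).prod * ((l₂.map e).prod * B p q) * F -
            (l₁.map e).prod * e q * (f p * ((l₂.map e).prod * F)) := by
        rw [← h2, ← h.fe p q]; noncomm_ring
      rw [e1]
      refine I.sub_mem ?_ h1
      rw [mul_assoc, mul_assoc, hBF', ← mul_assoc, ← mul_assoc]
      exact hB _ _ _
  obtain ⟨s, -, hs⟩ := exists_sign_of_perm (List.perm_cons_erase (hl1 p))
  have hk : ∀ q, q ≠ p ↔ q ∈ l.erase p := fun q => by
    rw [hl.mem_erase_iff]; simp [hl1 q]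
  have h1 := key (l.erase p) [] (by simpa using hl.erase p) (by simpa using hk)
  have h2 := h.e_anti.deriv_prod (commMap (B p p)) (commMap_mul _) (X p p) [] (l.erase p)
    (fun r _ => h.comm_e p p r) (fun r hr s _ hs => by
      have hsp : s = p := by
        by_contra hsp; exact hs ((hk s).mp hsp)
      have := (hk r).mpr hr
      subst hsp; exact h.fst_X s s r this this) (by simpa using hl.erase p)
  have h3 : ((l.erase p).map fun r => X p p r r).sum = ∑ r, X p p r r := by
    rw [← List.sum_toFinset _ (hl.erase p), ← Finset.sum_erase (f := fun r => X p p r r) Finset.univ (h.self_X p)]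
    congr 1
    ext q
    simp [← hk q]
  rw [h3, commMap_apply] at h2
  simp only [List.map_nil, List.prod_nil, one_mul] at h1 h2
  have e1 : f p * (e p * ((l.erase p).map e).prod * F) =
      ((l.erase p).map e).prod * F * B p p - e p * (f p * (((l.erase p).map e).prod * F)) := by
    have e2 : f p * e p = B p p - e p * f p := by rw [← h.fe p p]; abel
    have e3 : B p p * ((l.erase p).map e).prod * F = ((l.erase p).map e).prod * F * B p p := by
      rw [sub_eq_iff_eq_add.mp h2, add_mul, mul_assoc, hBF, mul_add, smul_mul_assoc, mul_smul_comm,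
        mul_assoc, add_comm, add_assoc, ← add_smul, add_comm (∑ r, Y p p r r), h.trace]
      simp
    rw [← mul_assoc, ← mul_assoc, e2, ← e3]
    noncomm_ring
  rw [hs R e h.e_anti, List.map_cons, List.prod_cons, smul_mul_assoc, mul_smul_comm, e1,
    ← algebraMap_smul R s, smul_eq_mul]
  exact I.mul_mem_left _ (I.sub_mem (hB _ _ _) (I.mul_mem_left _ h1))

end OddPair


/-! ### The odd generators of `U(sl(m|n))` and the element `Γ` -/

section Gamma

variable {m n : ℕ}

/-- The odd generator `E_{iμ}` of `U(sl(m|n))`, for `p = (i, μ)`. -/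
def oddE (p : Fin m × Fin n) : U m n := E (.inl p.1) (.inr p.2) Sum.inl_ne_inr

/-- The odd generator `E_{μi}` of `U(sl(m|n))`, for `p = (i, μ)`. -/
def oddF (p : Fin m × Fin n) : U m n := E (.inr p.2) (.inl p.1) Sum.inr_ne_inl

/-- The list `(m, 1), …, (m, n), …, (1, 1), …, (1, n)` of index pairs, i.e. the order of the
factors of `𝔼`. -/
def orderE (m n : ℕ) : List (Fin m × Fin n) :=
  ((List.ofFn fun i => List.ofFn fun μ => (i, μ)).reverse).flatten

/-- The list `(m, n), …, (m, 1), …, (1, n), …, (1, 1)` of index pairs, i.e. the order of the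
factors of `Θ` and `Θ̄`. -/
def orderΘ (m n : ℕ) : List (Fin m × Fin n) :=
  ((List.ofFn fun i => (List.ofFn fun μ => (i, μ)).reverse).reverse).flatten

theorem nodup_orderE : (orderE m n).Nodup := by
  rw [orderE, List.nodup_flatten, List.pairwise_reverse, List.pairwise_ofFn]
  refine ⟨fun l hl => ?_, fun i j hij => ?_⟩
  · rw [List.mem_reverse, List.mem_ofFn] at hl
    obtain ⟨i, rfl⟩ := hl
    exact List.nodup_ofFn.mpr fun μ ν h => (Prod.mk.inj h).2
  · intro p h1 h2
    rw [List.mem_ofFn] at h1 h2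
    obtain ⟨μ, rfl⟩ := h1
    obtain ⟨ν, h⟩ := h2
    exact hij.ne (Prod.mk.inj h).1

theorem mem_orderE (p : Fin m × Fin n) : p ∈ orderE m n := by
  simp only [orderE, List.mem_flatten, List.mem_reverse, List.mem_ofFn]
  exact ⟨_, ⟨p.1, rfl⟩, List.mem_ofFn.mpr ⟨p.2, rfl⟩⟩

theorem orderΘ_perm : (orderΘ m n).Perm (orderE m n) := by
  have h : ∀ L : List (List (Fin m × Fin n)), (L.map List.reverse).flatten.Perm L.flatten := by
    intro L
    induction L with
    | nil => simp
    | cons l L ih => simpa using (List.reverse_perm l).append ih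
  have e : orderΘ m n = (((List.ofFn fun i => List.ofFn fun μ => (i, μ)).reverse).map
      List.reverse).flatten := by
    rw [orderΘ, List.map_reverse, List.map_ofFn]
    rfl
  rw [e]
  exact h _

theorem length_orderE : (orderE m n).length = m * n := by
  have h := List.toFinset_card_of_nodup (nodup_orderE (m := m) (n := n))
  rw [← h, (Finset.eq_univ_iff_forall.mpr fun p => by simp [mem_orderE] :
    (orderE m n).toFinset = Finset.univ)]
  simp

theorem EE_eq : EE m n = ((orderE m n).map oddE).prod := by
  rw [orderE, List.map_flatten, List.prod_flatten, List.map_reverse, List.map_reverse,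
    List.map_ofFn, List.map_ofFn, EE]
  congr 3
  funext i
  simp only [Function.comp_apply, List.map_ofFn]
  rfl

theorem FF_eq : FF m n = ((orderE m n).reverse.map oddF).prod := by
  rw [orderE, List.reverse_flatten, List.map_reverse, List.reverse_reverse, List.map_flatten,
    List.prod_flatten, List.map_ofFn, List.map_ofFn, List.map_ofFn, FF]
  congr 2
  funext i
  simp only [Function.comp_apply, List.map_reverse, List.map_ofFn]
  rfl

theorem Θ_eq : Θ m n = ((orderΘ m n).map fun p => t (.inl p.1) (.inr p.2)).prod := by
  rw [orderΘ, List.map_flatten, List.prod_flatten, List.map_reverse, List.map_reverse,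
    List.map_ofFn, List.map_ofFn, Θ]
  congr 3
  funext i
  simp only [Function.comp_apply, List.map_reverse, List.map_ofFn]
  rfl

theorem Θbar_eq : Θbar m n = ((orderΘ m n).map fun p => tbar (.inl p.1) (.inr p.2)).prod := by
  rw [orderΘ, List.map_flatten, List.prod_flatten, List.map_reverse, List.map_reverse,
    List.map_ofFn, List.map_ofFn, Θbar]
  congr 3
  funext i
  simp only [Function.comp_apply, List.map_reverse, List.map_ofFn]
  rfl

theorem single_mem_part {p : ZMod 2} {a b : Fin m ⊕ Fin n} (h : par a + par b = p) :
    Matrix.single a b (1 : ℂ) ∈ Mat.part m n p := by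
  intro c d hcd
  rw [Matrix.single_apply, if_neg]
  rintro ⟨rfl, rfl⟩
  exact hcd h

/-- The matrix of `ad x` on the `E_{iμ}`, for an even matrix `x`. Its negative transpose is the
matrix of `ad x` on the `E_{μi}`. -/
def adE (x : Mat m n) (s r : Fin m × Fin n) : ℂ :=
  (if s.2 = r.2 then x (.inl s.1) (.inl r.1) else 0) -
    (if s.1 = r.1 then x (.inr r.2) (.inr s.2) else 0)

theorem sum_smul_ι {κ : Type*} [Fintype κ] (c : κ → ℂ) (y : κ → sl m n) :
    ∑ s, c s • U.ι (y s) = U.ι (∑ s, c s • y s) := by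
  simp

theorem apply_inl_inr {x : Mat m n} (hx : x ∈ Mat.part m n 0) (i : Fin m) (μ : Fin n) :
    x (.inl i) (.inr μ) = 0 := hx _ _ (by simp [par])

theorem apply_inr_inl {x : Mat m n} (hx : x ∈ Mat.part m n 0) (i : Fin m) (μ : Fin n) :
    x (.inr μ) (.inl i) = 0 := hx _ _ (by simp [par])

theorem comm_oddE {x : sl m n} (hx : x.1 ∈ Mat.part m n 0) (r : Fin m × Fin n) :
    U.ι x * oddE r - oddE r * U.ι x = ∑ s, adE x.1 s r • oddE s := by
  simp only [oddE, E]
  rw [U.rel hx (single_mem_part (p := 1) (by simp [par])), sum_smul_ι, zero_mul, psign_zero,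
    one_smul, add_sub_cancel_left]
  congr 1
  apply Subtype.ext
  ext a b
  simp only [superBracket, zero_mul, psign_zero, one_smul, Submodule.coe_sum, Submodule.coe_smul]
  rw [Matrix.sum_apply, Fintype.sum_prod_type]
  rcases a with a | a <;> rcases b with b | b <;>
    simp [Matrix.single_apply, Matrix.mul_apply, adE, apply_inr_inl hx, ite_and]
  congr 1 <;> simp [eq_comm]

theorem comm_oddF {x : sl m n} (hx : x.1 ∈ Mat.part m n 0) (r : Fin m × Fin n) :
    U.ι x * oddF r - oddF r * U.ι x = ∑ s, -adE x.1 r s • oddF s := by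
  simp only [oddF, E]
  rw [U.rel hx (single_mem_part (p := 1) (by simp [par])), sum_smul_ι, zero_mul, psign_zero,
    one_smul, add_sub_cancel_left]
  congr 1
  apply Subtype.ext
  ext a b
  simp only [superBracket, zero_mul, psign_zero, one_smul, Submodule.coe_sum, Submodule.coe_smul]
  rw [Matrix.sum_apply, Fintype.sum_prod_type]
  rcases a with a | a <;> rcases b with b | b <;>
    simp [Matrix.single_apply, Matrix.mul_apply, adE, apply_inl_inr hx, ite_and]

theorem antiComm_oddE : AntiComm (oddE (m := m) (n := n)) := by
  intro p q
  simp only [oddE, E]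
  rw [U.rel (single_mem_part (p := 1) (by simp [par])) (single_mem_part (p := 1) (by simp [par]))]
  have : ∀ h, U.ι (⟨superBracket 1 1 (Matrix.single (.inl p.1) (.inr p.2) (1 : ℂ))
      (Matrix.single (.inl q.1) (.inr q.2) (1 : ℂ)), h⟩ : sl m n) = 0 := by
    intro h
    rw [← map_zero U.ι]
    congr 1
    apply Subtype.ext
    simp [superBracket]
  simp [this, psign_one]

theorem antiComm_oddF : AntiComm (oddF (m := m) (n := n)) := by
  intro p q
  simp only [oddF, E]
  rw [U.rel (single_mem_part (p := 1) (by simp [par])) (single_mem_part (p := 1) (by simp [par]))]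
  have : ∀ h, U.ι (⟨superBracket 1 1 (Matrix.single (.inr p.2) (.inl p.1) (1 : ℂ))
      (Matrix.single (.inr q.2) (.inl q.1) (1 : ℂ)), h⟩ : sl m n) = 0 := by
    intro h
    rw [← map_zero U.ι]
    congr 1
    apply Subtype.ext
    simp [superBracket]
  simp [this, psign_one]

/-- The even matrix `{E_{μi}, E_{jν}} = δ_{ij} E_{μν} + δ_{μν} E_{ji}`, for `p = (i, μ)` and
`q = (j, ν)`. -/
def bracketFE (p q : Fin m × Fin n) : sl m n :=
  ⟨superBracket 1 1 (Matrix.single (.inr p.2) (.inl p.1) 1) (Matrix.single (.inl q.1) (.inr q.2) 1),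
    superBracket_mem (single_mem_part (by simp [par])) (single_mem_part (by simp [par]))⟩

theorem bracketFE_mem (p q : Fin m × Fin n) : (bracketFE p q).1 ∈ Mat.part m n 0 :=
  superBracket_mem_part (p := 1) (q := 1)
    (single_mem_part (by simp [par])) (single_mem_part (by simp [par]))

theorem single_mul_single_apply (a b c d x y : Fin m ⊕ Fin n) :
    (Matrix.single a b (1 : ℂ) * Matrix.single c d 1 : Mat m n) x y =
      if a = x ∧ b = c ∧ d = y then 1 else 0 := by
  by_cases h : b = c
  · subst h; simp [Matrix.single_apply]
  · simp [h]

theorem adE_bracketFE (p q s r : Fin m × Fin n) : adE (bracketFE p q).1 s r =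
    (if s.2 = r.2 ∧ p.2 = q.2 ∧ s.1 = q.1 ∧ r.1 = p.1 then 1 else 0) -
      (if s.1 = r.1 ∧ p.1 = q.1 ∧ r.2 = p.2 ∧ s.2 = q.2 then 1 else 0) := by
  simp only [adE, bracketFE, superBracket, one_mul, psign_one, neg_smul, one_smul, sub_neg_eq_add,
    Matrix.add_apply]
  simp only [single_mul_single_apply, Sum.inl.injEq, Sum.inr.injEq, reduceCtorEq,
    zero_add, add_zero, if_false, and_false]
  grind

theorem oddPair : OddPair (oddE (m := m) (n := n)) oddF (fun p q => U.ι (bracketFE p q))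
    (fun p q => adE (bracketFE p q).1) (fun p q s r => -adE (bracketFE p q).1 r s) where
  e_anti := antiComm_oddE
  f_anti := antiComm_oddF
  fe p q := by
    simp only [oddE, oddF, E]
    rw [U.rel (single_mem_part (p := 1) (by simp [par]))
      (single_mem_part (p := 1) (by simp [par]))]
    simp [psign_one, bracketFE]
  comm_e p q r := comm_oddE (bracketFE_mem p q) r
  comm_f p q r := comm_oddF (bracketFE_mem p q) r
  diag_X p q r hpq := by simp only [adE_bracketFE]; grind
  diag_Y p q r hpq := by simp only [adE_bracketFE]; grind
  self_X p := by simp only [adE_bracketFE]; grind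
  self_Y p := by simp only [adE_bracketFE]; grind
  trace p := by simp
  fst_X p q r h1 h2 := by simp only [adE_bracketFE]; grind
  snd_X p q r h1 h2 := by simp only [adE_bracketFE]; grind
  fst_Y p q r h1 h2 := by simp only [adE_bracketFE]; grind
  snd_Y p q r h1 h2 := by simp only [adE_bracketFE]; grind

theorem Γ_eq : Γ m n = ((orderE m n).map oddE).prod * ((orderE m n).reverse.map oddF).prod := by
  rw [Γ, EE_eq, FF_eq]

/-- `Γ` commutes with the even part. -/
theorem ι_mul_Γ {x : sl m n} (hx : x.1 ∈ Mat.part m n 0) : U.ι x * Γ m n = Γ m n * U.ι x := by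
  have h1 := antiComm_oddE.deriv_prod_full (commMap (U.ι x)) (commMap_mul _) (adE x.1)
    (orderE m n) (comm_oddE hx) nodup_orderE mem_orderE
  have h2 := antiComm_oddF.deriv_prod_full (commMap (U.ι x)) (commMap_mul _)
    (fun s r => -adE x.1 r s) (orderE m n).reverse (comm_oddF hx)
    (List.nodup_reverse.mpr nodup_orderE) (fun p => List.mem_reverse.mpr (mem_orderE p))
  rw [← sub_eq_zero, ← commMap_apply, Γ_eq, commMap_mul, h1, h2]
  simp

/-- `sl(m|n)` is spanned by its even part and the odd generators. -/
theorem ι_decomp (x : sl m n) : ∃ (y : sl m n) (c d : Fin m × Fin n → ℂ), y.1 ∈ Mat.part m n 0 ∧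
    U.ι x = U.ι y + ∑ p, c p • oddE p + ∑ p, d p • oddF p := by
  obtain ⟨y, z, hy, hz, rfl⟩ := sl_homog x
  refine ⟨y, fun p => z.1 (.inl p.1) (.inr p.2), fun p => z.1 (.inr p.2) (.inl p.1), hy, ?_⟩
  simp only [oddE, oddF, E]
  rw [sum_smul_ι, sum_smul_ι, ← map_add, ← map_add, add_assoc]
  congr 2
  apply Subtype.ext
  ext a b
  simp only [Submodule.coe_add, Submodule.coe_sum, Submodule.coe_smul]
  rw [Matrix.add_apply, Matrix.sum_apply, Matrix.sum_apply, Fintype.sum_prod_type,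
    Fintype.sum_prod_type]
  rcases a with a | a <;> rcases b with b | b <;>
    simp [Matrix.single_apply, ite_and]
  · exact hz _ _ (by simp [par])
  · exact hz _ _ (by simp [par, add_self_zmod2])

/-- `x Γ` is in the left ideal generated by the even part, for all `x` in `sl(m|n)`. -/
theorem ι_mul_Γ_mem (x : sl m n) :
    U.ι x * Γ m n ∈ Ideal.span {b : U m n | ∃ y : sl m n, y.1 ∈ Mat.part m n 0 ∧ b = U.ι y} := by
  set I := Ideal.span {b : U m n | ∃ y : sl m n, y.1 ∈ Mat.part m n 0 ∧ b = U.ι y}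
  have hs : ∀ (c : ℂ) z, z ∈ I → c • z ∈ I := fun c z hz => by
    rw [← algebraMap_smul (U m n) c]; exact I.mul_mem_left _ hz
  obtain ⟨y, c, d, hy, h⟩ := ι_decomp x
  rw [h, add_mul, add_mul, ι_mul_Γ hy, Finset.sum_mul, Finset.sum_mul]
  refine I.add_mem (I.add_mem (I.mul_mem_left _ (Ideal.subset_span ⟨y, hy, rfl⟩)) ?_) ?_
  · refine I.sum_mem fun p _ => ?_
    rw [Γ_eq, smul_mul_assoc, ← mul_assoc, antiComm_oddE.mul_prod_of_mem (mem_orderE p)]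
    simp
  · refine I.sum_mem fun p _ => ?_
    rw [smul_mul_assoc, Γ_eq]
    refine hs _ _ (Ideal.span_mono ?_ (oddPair.mul_mem p nodup_orderE mem_orderE
      (List.nodup_reverse.mpr nodup_orderE) fun p => List.mem_reverse.mpr (mem_orderE p)))
    rintro _ ⟨p, q, rfl⟩
    exact ⟨_, bracketFE_mem p q, rfl⟩

open MulOpposite in
/-- `Γ x` is in the right ideal generated by the even part, for all `x` in `sl(m|n)`. Right ideals
are expressed as left ideals of the opposite algebra. -/
theorem op_Γ_mul_ι_mem (x : sl m n) : op (Γ m n * U.ι x) ∈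
    Ideal.span {b : (U m n)ᵐᵒᵖ | ∃ y : sl m n, y.1 ∈ Mat.part m n 0 ∧ b = op (U.ι y)} := by
  set I := Ideal.span {b : (U m n)ᵐᵒᵖ | ∃ y : sl m n, y.1 ∈ Mat.part m n 0 ∧ b = op (U.ι y)}
  have hs : ∀ (c : ℂ) z, z ∈ I → c • z ∈ I := fun c z hz => by
    rw [← algebraMap_smul (U m n)ᵐᵒᵖ c]; exact I.mul_mem_left _ hz
  obtain ⟨y, c, d, hy, h⟩ := ι_decomp x
  rw [h, mul_add, mul_add, ← ι_mul_Γ hy, Finset.mul_sum, Finset.mul_sum, op_add, op_add,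
    Finset.op_sum, Finset.op_sum, op_mul]
  refine I.add_mem (I.add_mem (I.mul_mem_left _ (Ideal.subset_span ⟨y, hy, rfl⟩)) ?_) ?_
  · refine I.sum_mem fun p _ => ?_
    rw [mul_smul_comm, op_smul]
    refine hs _ _ (Ideal.span_mono ?_ (?_ : _ ∈ Ideal.span {b | ∃ p q : Fin m × Fin n,
      b = op (U.ι (bracketFE q p))}))
    · rintro _ ⟨p, q, rfl⟩
      exact ⟨_, bracketFE_mem q p, rfl⟩
    · have := oddPair.op.mul_mem p nodup_orderE mem_orderE
        (List.nodup_reverse.mpr nodup_orderE) (fun p => List.mem_reverse.mpr (mem_orderE p))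
      have h (g : Fin m × Fin n → U m n) (l : List (Fin m × Fin n)) :
          (l.map fun p => op (g p)).prod = op (l.reverse.map g).prod := by
        rw [op_list_prod, List.map_map, ← List.map_reverse, List.reverse_reverse]; rfl
      rw [h, h, List.reverse_reverse, ← op_mul, ← op_mul, ← Γ_eq] at this
      exact this
  · refine I.sum_mem fun p _ => ?_
    rw [Γ_eq, mul_smul_comm, mul_assoc,
      antiComm_oddF.prod_mul_of_mem (List.mem_reverse.mpr (mem_orderE p))]
    simp

end Gamma


/-! ### Translations and supercommutativity of linear forms -/

section Forms

variable {m n : ℕ}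

/-- The left translate `a ↦ a(y ·)` of linear forms. -/
def leftTr (y : U m n) : Module.Dual ℂ (U m n) →ₗ[ℂ] Module.Dual ℂ (U m n) :=
  (LinearMap.mulLeft ℂ y).dualMap

theorem leftTr_apply (y u : U m n) (f : Module.Dual ℂ (U m n)) : leftTr y f u = f (y * u) := rfl

theorem parityPow_zero : (U.parityPow 0 : U m n →ₗ[ℂ] U m n) = LinearMap.id := by
  simp [U.parityPow]

theorem parityPow_one : U.parityPow 1 = U.π m n := by
  simp [U.parityPow, U.π]

theorem leftTr_mul_even {x : sl m n} (hx : x.1 ∈ Mat.part m n 0) (f g : Module.Dual ℂ (U m n)) :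
    leftTr (U.ι x) (f * g) = leftTr (U.ι x) f * g + f * leftTr (U.ι x) g := by
  have h := dual_mul_mulLeft hx f g
  rw [parityPow_zero] at h
  exact h

theorem leftTr_mul_odd {x : sl m n} (hx : x.1 ∈ Mat.part m n 1) (f g : Module.Dual ℂ (U m n)) :
    leftTr (U.ι x) (f * g) = leftTr (U.ι x) f * (g ∘ₗ U.π m n) + f * leftTr (U.ι x) g := by
  have h := dual_mul_mulLeft hx f g
  rw [parityPow_one] at h
  exact h

theorem leftTr_one (x : sl m n) : leftTr (U.ι x) 1 = 0 := counit_mulLeft x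

theorem leftTr_parity {p q : ZMod 2} {x : sl m n} (hx : x.1 ∈ Mat.part m n p)
    {f : Module.Dual ℂ (U m n)} (hf : f ∘ₗ U.π m n = psign q • f) :
    leftTr (U.ι x) f ∘ₗ U.π m n = psign (p + q) • leftTr (U.ι x) f := by
  ext u
  have h := LinearMap.congr_fun hf (U.ι x * u)
  simp only [LinearMap.comp_apply, U.π, AlgHom.toLinearMap_apply, map_mul, U.parity_ι hx,
    smul_mul_assoc, map_smul, LinearMap.smul_apply, smul_eq_mul] at h
  simp only [LinearMap.comp_apply, leftTr_apply, LinearMap.smul_apply, smul_eq_mul, psign_add,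
    U.π, AlgHom.toLinearMap_apply, mul_assoc, ← h]
  rw [← mul_assoc, psign_mul_self, one_mul]

/-- The algebra of linear forms is supercommutative. -/
theorem dual_mul_comm {p q : ZMod 2} {f g : Module.Dual ℂ (U m n)}
    (hf : f ∘ₗ U.π m n = psign p • f) (hg : g ∘ₗ U.π m n = psign q • g) :
    f * g = psign (p * q) • (g * f) := by
  ext u
  induction u using U.induction generalizing f g p q with
  | h1 =>
    simp only [dual_mul_def, dual_mul_one, LinearMap.smul_apply, smul_eq_mul]
    rcases zmod2 p with rfl | rfl
    · simp [psign_zero, mul_comm]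
    · have : f 1 = 0 := by
        have h := LinearMap.congr_fun hf 1
        simp only [LinearMap.comp_apply, U.π, AlgHom.toLinearMap_apply, map_one,
          LinearMap.smul_apply, psign_one, smul_eq_mul] at h
        linear_combination h / 2
      simp [this]
  | hadd u v hu hv => simp only [map_add, hu hf hg, hv hf hg]
  | hsmul c u hu => simp only [map_smul, hu hf hg]
  | hι r x hx u hu =>
    have e (q : ZMod 2) (f : Module.Dual ℂ (U m n)) (hf : f ∘ₗ U.π m n = psign q • f) :
        f ∘ₗ U.parityPow r = psign (r * q) • f := by
      rcases zmod2 r with rfl | rfl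
      · simp [U.parityPow, psign_zero]
      · simpa [parityPow_one] using hf
    have h1 := hu (leftTr_parity hx hf) hg
    have h2 := hu hf (leftTr_parity hx hg)
    have e1 : ∀ f g : Module.Dual ℂ (U m n), (f * g) (U.ι x * u) =
        (leftTr (U.ι x) f * (g ∘ₗ U.parityPow r)) u + (f * leftTr (U.ι x) g) u :=
      fun f g => dual_mul_ι hx f g u
    rw [LinearMap.smul_apply, e1, e1, e q g hg, e p f hf, mul_smul_comm, mul_smul_comm,
      LinearMap.smul_apply, LinearMap.smul_apply, h1, h2]
    simp only [LinearMap.smul_apply, smul_eq_mul, add_mul, mul_add, psign_add, mul_comm p r]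
    linear_combination (psign (p * q) * (g * leftTr (U.ι x) f) u) * psign_mul_self (r * q)

theorem leftTr_vecForm (u : U m n) (a b : Fin m ⊕ Fin n) :
    leftTr u (vecForm a b) = ∑ c, vecRep m n u a c • vecForm c b := by
  ext v
  simp [leftTr_apply, vecForm, Matrix.mul_apply]

theorem leftTr_dualForm (u : U m n) (a b : Fin m ⊕ Fin n) :
    leftTr u (dualForm a b) = ∑ c, dualRep m n u a c • dualForm c b := by
  ext v
  simp [leftTr_apply, dualForm, Matrix.mul_apply]

theorem vecForm_parity (a b : Fin m ⊕ Fin n) :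
    vecForm a b ∘ₗ U.π m n = psign (par a + par b) • vecForm a b := by
  ext u; simp [vecForm, U.π, vecRep_parity, matParity]

theorem dualForm_parity (a b : Fin m ⊕ Fin n) :
    dualForm a b ∘ₗ U.π m n = psign (par a + par b) • dualForm a b := by
  ext u; simp [dualForm, U.π, dualRep_parity, matParity]

theorem antiComm_of_odd {ι : Type*} {θ : ι → Module.Dual ℂ (U m n)}
    (hθ : ∀ p, θ p ∘ₗ U.π m n = -θ p) : AntiComm θ := by
  intro p q
  have h := dual_mul_comm (p := 1) (q := 1) (f := θ p) (g := θ q)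
    (by simp [hθ, psign_one]) (by simp [hθ, psign_one])
  simpa [psign_one] using h

theorem prod_parity {ι : Type*} {θ : ι → Module.Dual ℂ (U m n)}
    (hθ : ∀ p, θ p ∘ₗ U.π m n = -θ p) (l : List ι) :
    (l.map θ).prod ∘ₗ U.π m n = (-1 : ℂ) ^ l.length • (l.map θ).prod := by
  induction l with
  | nil =>
    have h := counit_parityPow (m := m) (n := n) 1
    simpa [parityPow_one, dual_one_def] using h
  | cons p l ih =>
    rw [List.map_cons, List.prod_cons, dual_mul_def, dual_mul_π, hθ, ih, ← dual_mul_def,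
      ← dual_mul_def, List.length_cons, pow_succ]
    simp

end Forms

/-! ### Evaluation of products of odd forms on products of odd elements -/

section Pairing

variable {m n : ℕ} {ι : Type*} {e : ι → U m n}

/-- The elements of the family `e` are odd elements of `sl(m|n)`. -/
def OddFamily (e : ι → U m n) : Prop := ∀ p, ∃ x : sl m n, x.1 ∈ Mat.part m n 1 ∧ e p = U.ι x

/-- The linear forms that vanish on all products of elements of the family `e`, i.e. on the
subalgebra generated by the family. -/
def VanishesOn (e : ι → U m n) (g : Module.Dual ℂ (U m n)) : Prop :=
  ∀ l : List ι, g (l.map e).prod = 0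

/-- The linear forms that vanish on all products of less than `k` elements of the family `e`. -/
def VanishesBelow (e : ι → U m n) (k : ℕ) (g : Module.Dual ℂ (U m n)) : Prop :=
  ∀ l : List ι, l.length < k → g (l.map e).prod = 0

theorem OddFamily.leftTr_mul (he : OddFamily e) (p : ι) (f g : Module.Dual ℂ (U m n)) :
    leftTr (e p) (f * g) = leftTr (e p) f * (g ∘ₗ U.π m n) + f * leftTr (e p) g := by
  obtain ⟨x, hx, h⟩ := he p
  rw [h, leftTr_mul_odd hx]

theorem OddFamily.leftTr_one (he : OddFamily e) (p : ι) : leftTr (e p) 1 = 0 := by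
  obtain ⟨x, hx, h⟩ := he p
  rw [h, SuperInt.leftTr_one]

theorem OddFamily.mul_apply (he : OddFamily e) (p : ι) (u : U m n)
    (f g : Module.Dual ℂ (U m n)) :
    (f * g) (e p * u) = (leftTr (e p) f * (g ∘ₗ U.π m n)) u + (f * leftTr (e p) g) u := by
  rw [← leftTr_apply, he.leftTr_mul, LinearMap.add_apply]

theorem OddFamily.π_prod (he : OddFamily e) (l : List ι) :
    U.π m n (l.map e).prod = (-1 : ℂ) ^ l.length • (l.map e).prod := by
  induction l with
  | nil => simp [U.π]
  | cons p l ih =>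
    obtain ⟨x, hx, h⟩ := he p
    simp only [U.π, AlgHom.toLinearMap_apply] at ih
    simp [U.π, ih, h, U.parity_ι hx, psign_one, pow_succ]

theorem VanishesBelow.π {k : ℕ} {g : Module.Dual ℂ (U m n)} (he : OddFamily e)
    (hg : VanishesBelow e k g) : VanishesBelow e k (g ∘ₗ U.π m n) := by
  intro l hl
  rw [LinearMap.comp_apply, he.π_prod, map_smul, hg l hl, smul_zero]

theorem VanishesOn.π {g : Module.Dual ℂ (U m n)} (he : OddFamily e)
    (hg : VanishesOn e g) : VanishesOn e (g ∘ₗ U.π m n) := by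
  intro l
  rw [LinearMap.comp_apply, he.π_prod, map_smul, hg l, smul_zero]

theorem VanishesOn.translate {g : Module.Dual ℂ (U m n)} (hg : VanishesOn e g) (p : ι) :
    VanishesOn e (leftTr (e p) g) := fun l => by
  simpa [leftTr_apply] using hg (p :: l)

theorem VanishesBelow.translate {k : ℕ} {g : Module.Dual ℂ (U m n)} (hg : VanishesBelow e k g)
    (p : ι) : VanishesBelow e (k - 1) (leftTr (e p) g) := fun l hl => by
  have := hg (p :: l) (by simp; omega)
  simpa [leftTr_apply] using this

theorem VanishesOn.mul_left (he : OddFamily e) {g : Module.Dual ℂ (U m n)}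
    (hg : VanishesOn e g) (f : Module.Dual ℂ (U m n)) : VanishesOn e (f * g) := by
  intro l
  induction l generalizing f g with
  | nil =>
    have := hg []
    simp only [List.map_nil, List.prod_nil] at this ⊢
    rw [dual_mul_def, dual_mul_one, this, mul_zero]
  | cons p l ih =>
    rw [List.map_cons, List.prod_cons, he.mul_apply, ih (hg.π he), ih (hg.translate p), add_zero]

theorem VanishesOn.mul_right (he : OddFamily e) {f : Module.Dual ℂ (U m n)}
    (hf : VanishesOn e f) (g : Module.Dual ℂ (U m n)) : VanishesOn e (f * g) := by
  intro l
  induction l generalizing f g with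
  | nil =>
    have := hf []
    simp only [List.map_nil, List.prod_nil] at this ⊢
    rw [dual_mul_def, dual_mul_one, this, zero_mul]
  | cons p l ih =>
    rw [List.map_cons, List.prod_cons, he.mul_apply, ih hf, ih (hf.translate p), add_zero]

theorem VanishesBelow.mul (he : OddFamily e) {j k : ℕ} {f g : Module.Dual ℂ (U m n)}
    (hf : VanishesBelow e j f) (hg : VanishesBelow e k g) : VanishesBelow e (j + k) (f * g) := by
  intro l hl
  induction l generalizing f g j k with
  | nil =>
    rw [List.map_nil, List.prod_nil, dual_mul_def, dual_mul_one]
    rcases j.eq_zero_or_pos with rfl | hj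
    · have := hg [] (by simpa using hl)
      simp only [List.map_nil, List.prod_nil] at this
      rw [this, mul_zero]
    · have := hf [] (by simpa using hj)
      simp only [List.map_nil, List.prod_nil] at this
      rw [this, zero_mul]
  | cons p l ih =>
    rw [List.length_cons] at hl
    rw [List.map_cons, List.prod_cons, he.mul_apply, ih (hf.translate p) (hg.π he) (by omega),
      ih hf (hg.translate p) (by omega), add_zero]

theorem VanishesBelow.prod (he : OddFamily e) {θ : ι → Module.Dual ℂ (U m n)}
    (hθ : ∀ p, VanishesBelow e 1 (θ p)) (l : List ι) :
    VanishesBelow e l.length (l.map θ).prod := by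
  induction l with
  | nil => exact fun l hl => by simp at hl
  | cons p l ih =>
    rw [List.length_cons, add_comm]
    exact (hθ p).mul he ih

theorem VanishesBelow.mul_apply (he : OddFamily e) {g : Module.Dual ℂ (U m n)} {l : List ι}
    (hg : VanishesBelow e l.length g) (f : Module.Dual ℂ (U m n)) :
    (f * g) (l.map e).prod = f 1 * g (l.map e).prod := by
  induction l generalizing f g with
  | nil => simp [dual_mul_def, dual_mul_one]
  | cons p l ih =>
    have h0 : VanishesBelow e 0 (leftTr (e p) f) := fun _ h => absurd h (Nat.not_lt_zero _)
    rw [List.map_cons, List.prod_cons, he.mul_apply,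
      h0.mul he (hg.π he) l (by simp), ih (by simpa using hg.translate p), zero_add, leftTr_apply]

variable {θ : ι → Module.Dual ℂ (U m n)}

theorem vanishesOn_leftTr_prod [DecidableEq ι] (he : OddFamily e)
    (h : ∀ p q, VanishesOn e (leftTr (e p) (θ q) - (if p = q then 1 else 0))) {p : ι} {l : List ι}
    (hp : p ∉ l) : VanishesOn e (leftTr (e p) (l.map θ).prod) := by
  induction l with
  | nil =>
    intro l
    simp [he.leftTr_one]
  | cons q l ih =>
    intro l'
    have hpq : p ≠ q := fun hh => hp (by simp [hh])
    have h1 := h p q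
    rw [if_neg hpq, sub_zero] at h1
    have h2 := ih (fun hh => hp (by simp [hh]))
    rw [List.map_cons, List.prod_cons, he.leftTr_mul, LinearMap.add_apply, h1.mul_right he,
      h2.mul_left he, add_zero]

/-- If the odd forms `θ` are dual to the odd elements `e` (even after left translation, as far as
products of the `e` are concerned), then the product of the `θ` and that of the `e`, taken in the
same order, pair to the sign of the reversal. -/
theorem prod_apply_prod [DecidableEq ι] (he : OddFamily e) (hθ : ∀ p, θ p ∘ₗ U.π m n = -θ p)
    (h : ∀ p q, VanishesOn e (leftTr (e p) (θ q) - (if p = q then 1 else 0))) {l : List ι}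
    (hl : l.Nodup) : (l.map θ).prod (l.map e).prod = (-1) ^ l.length.choose 2 := by
  induction l with
  | nil => simp [dual_one_def]
  | cons p l ih =>
    rw [List.nodup_cons] at hl
    have h1 := h p p
    rw [if_pos rfl] at h1
    have h2 := h1.mul_right he ((l.map θ).prod ∘ₗ U.π m n) l
    have h3 := (vanishesOn_leftTr_prod he h hl.1).mul_left he (θ p) l
    rw [sub_mul, one_mul, LinearMap.sub_apply, sub_eq_zero] at h2
    rw [List.map_cons, List.prod_cons, List.map_cons, List.prod_cons, he.mul_apply, h2, h3,
      prod_parity hθ, LinearMap.smul_apply, ih hl.2, List.length_cons, Nat.choose_succ_succ' _ 1,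
      Nat.choose_one_right, pow_add, add_zero, smul_eq_mul]

/-- In opposite orders the products pair to `1`. -/
theorem prod_apply_prod_reverse [DecidableEq ι] (he : OddFamily e)
    (h : ∀ p q, VanishesOn e (leftTr (e p) (θ q) - (if p = q then 1 else 0))) {l : List ι}
    (hl : l.Nodup) : (l.map θ).prod (l.reverse.map e).prod = 1 := by
  induction l using List.reverseRecOn with
  | nil => simp [dual_one_def]
  | append_singleton l p ih =>
    have hp : p ∉ l ∧ l.Nodup := by
      simp only [List.nodup_append] at hl
      exact ⟨fun hh => hl.2.2 p hh p (by simp) rfl, hl.1⟩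
    have h1 := h p p
    rw [if_pos rfl] at h1
    have h2 := h1.mul_left he (l.map θ).prod l.reverse
    have h3 := (vanishesOn_leftTr_prod he h hp.1).mul_right he (θ p ∘ₗ U.π m n) l.reverse
    rw [mul_sub, mul_one, LinearMap.sub_apply, sub_eq_zero] at h2
    simp only [List.map_append, List.map_cons, List.map_nil, List.prod_append, List.prod_cons,
      List.prod_nil, mul_one, List.reverse_append, List.reverse_cons, List.reverse_nil,
      List.nil_append, List.cons_append]
    rw [he.mul_apply, h2, h3, ih hp.2, zero_add]

/-- If all the `e p` kill `g`, they act on `f * g` through `f`. -/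
theorem mul_apply_of_killed (he : OddFamily e) {g : Module.Dual ℂ (U m n)} {s : ℂ}
    (hg : g ∘ₗ U.π m n = s • g) (h : ∀ p, leftTr (e p) g = 0) (f : Module.Dual ℂ (U m n))
    (l : List ι) (v : U m n) :
    (f * g) ((l.map e).prod * v) = s ^ l.length * (leftTr (l.map e).prod f * g) v := by
  induction l generalizing f with
  | nil =>
    have : leftTr (1 : U m n) f = f := by ext; simp [leftTr_apply]
    simp [this]
  | cons p l ih =>
    have e1 : leftTr (l.map e).prod (leftTr (e p) f) = leftTr (e p * (l.map e).prod) f := by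
      ext; simp [leftTr_apply, mul_assoc]
    rw [List.map_cons, List.prod_cons, mul_assoc, he.mul_apply, h, mul_zero,
      LinearMap.zero_apply, add_zero, hg, mul_smul_comm, LinearMap.smul_apply, ih, e1,
      List.length_cons, pow_succ, smul_eq_mul]
    ring

end Pairing

/-! ### The forms `Θ` and `Θ̄` -/

section Theta

variable {m n : ℕ}

theorem oddFamily_oddE : OddFamily (oddE (m := m) (n := n)) := fun _ =>
  ⟨_, single_mem_part (by simp [par]), rfl⟩

theorem oddFamily_oddF : OddFamily (oddF (m := m) (n := n)) := fun _ =>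
  ⟨_, single_mem_part (by simp [par]), rfl⟩

/-- The form `t_{iμ}`, for `p = (i, μ)`. -/
def vecOdd (p : Fin m × Fin n) : Module.Dual ℂ (U m n) := vecForm (.inl p.1) (.inr p.2)

/-- The form `t̄_{iμ}`, for `p = (i, μ)`. -/
def dualOdd (p : Fin m × Fin n) : Module.Dual ℂ (U m n) := dualForm (.inl p.1) (.inr p.2)

theorem vecOdd_parity (p : Fin m × Fin n) : vecOdd p ∘ₗ U.π m n = -vecOdd p := by
  rw [vecOdd, vecForm_parity]; simp [par, psign_one]

theorem dualOdd_parity (p : Fin m × Fin n) : dualOdd p ∘ₗ U.π m n = -dualOdd p := by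
  rw [dualOdd, dualForm_parity]; simp [par, psign_one]

theorem coe_Θ : (Θ m n).1 = ((orderΘ m n).map vecOdd).prod := by
  rw [Θ_eq, ← Subalgebra.coe_val, map_list_prod, List.map_map]
  rfl

theorem coe_Θbar : (Θbar m n).1 = ((orderΘ m n).map dualOdd).prod := by
  rw [Θbar_eq, ← Subalgebra.coe_val, map_list_prod, List.map_map]
  rfl

theorem vecRep_oddE (p : Fin m × Fin n) :
    vecRep m n (oddE p) = Matrix.single (.inl p.1) (.inr p.2) 1 := by
  rw [oddE, E, vecRep_ι]

theorem dualRep_oddE (p : Fin m × Fin n) :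
    dualRep m n (oddE p) = -Matrix.single (.inr p.2) (.inl p.1) 1 := by
  rw [oddE, E, dualRep_ι]
  ext a b
  rcases a with a | a <;> rcases b with b | b <;>
    simp [negST, Matrix.single_apply, par, psign, and_comm]

theorem dualRep_oddF (p : Fin m × Fin n) :
    dualRep m n (oddF p) = Matrix.single (.inl p.1) (.inr p.2) 1 := by
  rw [oddF, E, dualRep_ι]
  ext a b
  rcases a with a | a <;> rcases b with b | b <;>
    simp [negST, Matrix.single_apply, par, psign, and_comm]

theorem vecOdd_dual (p q : Fin m × Fin n) :
    VanishesOn oddE (leftTr (oddE p) (vecOdd q) - (if p = q then 1 else 0)) := by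
  intro l
  cases l with
  | nil =>
    by_cases hpq : p = q
    · simp [hpq, vecOdd, leftTr_apply, vecRep_oddE, dual_one_def, vecForm]
    · have : ¬ (p.1 = q.1 ∧ p.2 = q.2) := fun h => hpq (Prod.ext h.1 h.2)
      simp [hpq, vecOdd, leftTr_apply, vecForm, vecRep_oddE, this]
  | cons r l =>
    have h1 : leftTr (oddE r) (leftTr (oddE p) (vecOdd q)) = 0 := by
      simp only [vecOdd, leftTr_vecForm, vecRep_oddE, map_sum, map_smul]
      simp [Matrix.single_apply]
    have h2 : leftTr (oddE r) (if p = q then 1 else 0) = 0 := by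
      split_ifs
      · exact oddFamily_oddE.leftTr_one r
      · simp
    rw [List.map_cons, List.prod_cons, ← leftTr_apply, map_sub, h1, h2]
    simp

theorem dualOdd_dual (p q : Fin m × Fin n) :
    VanishesOn oddF (leftTr (oddF p) (dualOdd q) - (if p = q then 1 else 0)) := by
  intro l
  cases l with
  | nil =>
    by_cases hpq : p = q
    · simp [hpq, dualOdd, leftTr_apply, dualRep_oddF, dual_one_def, dualForm]
    · have : ¬ (p.1 = q.1 ∧ p.2 = q.2) := fun h => hpq (Prod.ext h.1 h.2)
      simp [hpq, dualOdd, leftTr_apply, dualForm, dualRep_oddF, this]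
  | cons r l =>
    have h1 : leftTr (oddF r) (leftTr (oddF p) (dualOdd q)) = 0 := by
      simp only [dualOdd, leftTr_dualForm, dualRep_oddF, map_sum, map_smul]
      simp [Matrix.single_apply]
    have h2 : leftTr (oddF r) (if p = q then 1 else 0) = 0 := by
      split_ifs
      · exact oddFamily_oddF.leftTr_one r
      · simp
    rw [List.map_cons, List.prod_cons, ← leftTr_apply, map_sub, h1, h2]
    simp

theorem oddE_dualOdd (p q : Fin m × Fin n) : leftTr (oddE p) (dualOdd q) = 0 := by
  simp [dualOdd, leftTr_dualForm, dualRep_oddE]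

theorem dualOdd_vanishesBelow (p : Fin m × Fin n) : VanishesBelow oddF 1 (dualOdd p) := by
  intro l hl
  obtain rfl : l = [] := by simpa using hl
  simp [dualOdd, dualForm]

/-- The value of `Θ Θ̄` on `Γ`. -/
theorem Θ_mul_Θbar_Γ : (Θ m n * Θbar m n).1 (Γ m n) = (-1) ^ (m * n * (m * n + 1) / 2) := by
  obtain ⟨s, hs, h⟩ := exists_sign_of_perm (orderΘ_perm (m := m) (n := n))
  have hkill (l : List (Fin m × Fin n)) (p : Fin m × Fin n) :
      leftTr (oddE p) (l.map dualOdd).prod = 0 := by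
    induction l with
    | nil => exact oddFamily_oddE.leftTr_one p
    | cons q l ih =>
      rw [List.map_cons, List.prod_cons, oddFamily_oddE.leftTr_mul, oddE_dualOdd, ih]
      simp
  have hvan : VanishesBelow oddF (orderE m n).reverse.length ((orderE m n).map dualOdd).prod := by
    rw [List.length_reverse]
    exact VanishesBelow.prod oddFamily_oddF dualOdd_vanishesBelow _
  have hN := Nat.choose_two_right (m * n + 1)
  rw [Nat.choose_succ_succ' _ 1, Nat.choose_one_right, Nat.add_sub_cancel,
    mul_comm (m * n + 1)] at hN
  rw [MulMemClass.coe_mul, coe_Θ, coe_Θbar, h _ _ (antiComm_of_odd vecOdd_parity),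
    h _ _ (antiComm_of_odd dualOdd_parity), smul_mul_smul_comm, hs, one_smul, Γ_eq,
    mul_apply_of_killed oddFamily_oddE (prod_parity dualOdd_parity _) (hkill _),
    hvan.mul_apply oddFamily_oddF, leftTr_apply, mul_one,
    prod_apply_prod oddFamily_oddE vecOdd_parity vecOdd_dual nodup_orderE,
    prod_apply_prod_reverse oddFamily_oddF dualOdd_dual nodup_orderE, length_orderE, mul_one,
    ← hN, pow_add]
  congr 1
  rcases Nat.even_or_odd (m * n) with hE | hO
  · simp [hE.neg_one_pow]
  · simp [hO.neg_one_pow]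

/-- `Θ Θ̄` is invariant under left translations by the even part: `Θ` and `Θ̄` are multiplied by
opposite traces. -/
theorem leftTr_Θ_mul_Θbar {x : sl m n} (hx : x.1 ∈ Mat.part m n 0) :
    leftTr (U.ι x) (Θ m n * Θbar m n).1 = 0 := by
  have hp : (orderΘ m n).Nodup := orderΘ_perm.nodup_iff.mpr nodup_orderE
  have hm : ∀ p, p ∈ orderΘ m n := fun p => orderΘ_perm.mem_iff.mpr (mem_orderE p)
  have h1 := (antiComm_of_odd vecOdd_parity).deriv_prod_full (leftTr (U.ι x))
    (leftTr_mul_even hx) (fun s r => if s.2 = r.2 then x.1 (.inl r.1) (.inl s.1) else 0)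
    (orderΘ m n) (fun r => by
      rw [vecOdd, leftTr_vecForm, vecRep_ι, Fintype.sum_prod_type]
      simp [vecOdd, apply_inl_inr hx]) hp hm
  have h2 := (antiComm_of_odd dualOdd_parity).deriv_prod_full (leftTr (U.ι x))
    (leftTr_mul_even hx) (fun s r => if s.2 = r.2 then -x.1 (.inl s.1) (.inl r.1) else 0)
    (orderΘ m n) (fun r => by
      rw [dualOdd, leftTr_dualForm, dualRep_ι, Fintype.sum_prod_type]
      simp [dualOdd, negST, par, psign, apply_inr_inl hx]) hp hm
  rw [MulMemClass.coe_mul, coe_Θ, coe_Θbar, leftTr_mul_even hx, h1, h2]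
  simp

end Theta


/-! ### Complete reducibility from an invariant inner product -/

section Unitary

variable {E M X : Type*} [NormedAddCommGroup E] [InnerProductSpace ℂ E] [FiniteDimensional ℂ E]
  [AddCommGroup M] [Module ℂ M] {st : X → X} {σ : X → E →ₗ[ℂ] E} {L : X → M →ₗ[ℂ] M}
  {F : E →ₗ[ℂ] M}

/-- In a quotient of a unitary representation, a nonzero invariant vector is not in the span of
the images of the operators: its lift orthogonal to the kernel is invariant too, hence orthogonal
to these images. -/
theorem notMem_span_of_unitary (adj : ∀ x u v, inner ℂ (σ (st x) u) v = inner ℂ u (σ x v))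
    (hF : ∀ x v, F (σ x v) = L x (F v)) {v : E} (hv : F v ≠ 0) (hinv : ∀ x, L x (F v) = 0) :
    F v ∉ Submodule.span ℂ {b | ∃ x u, b = L x (F u)} := by
  intro hmem
  set K := LinearMap.ker F
  obtain ⟨k, hk, w, hw, hvw⟩ := Submodule.exists_add_mem_mem_orthogonal (K := K) v
  have hFw : F w = F v := by rw [hvw, map_add, LinearMap.mem_ker.mp hk, zero_add]
  have hσw : ∀ x, σ x w = 0 := by
    intro x
    have h1 : σ x w ∈ K := by
      rw [LinearMap.mem_ker, hF, hFw, hinv]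
    have h2 : σ x w ∈ Kᗮ := by
      rw [Submodule.mem_orthogonal]
      intro k hk
      rw [← adj]
      refine (Submodule.mem_orthogonal _ _).mp hw _ ?_
      rw [LinearMap.mem_ker, hF, LinearMap.mem_ker.mp hk, map_zero]
    exact inner_self_eq_zero.mp ((Submodule.mem_orthogonal _ _).mp h2 _ h1)
  have h3 : ∀ b ∈ Submodule.span ℂ {b | ∃ x u, b = L x (F u)}, ∃ s, F s = b ∧ inner ℂ w s = 0 := by
    intro b hb
    induction hb using Submodule.span_induction with
    | mem b hb =>
      obtain ⟨x, u, rfl⟩ := hb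
      exact ⟨σ x u, hF x u, by rw [← adj, hσw, inner_zero_left]⟩
    | zero => exact ⟨0, by simp, by simp⟩
    | add a b _ _ ha hb =>
      obtain ⟨s, hs, hs'⟩ := ha
      obtain ⟨r, hr, hr'⟩ := hb
      exact ⟨s + r, by rw [map_add, hs, hr], by rw [inner_add_right, hs', hr', add_zero]⟩
    | smul c b _ hb =>
      obtain ⟨s, hs, hs'⟩ := hb
      exact ⟨c • s, by rw [map_smul, hs], by rw [inner_smul_right, hs', mul_zero]⟩
  obtain ⟨s, hs, hs'⟩ := h3 _ hmem
  have h4 : s - w ∈ K := by rw [LinearMap.mem_ker, map_sub, hs, hFw, sub_self]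
  have h5 : inner ℂ w w = (0 : ℂ) := by
    have := (Submodule.mem_orthogonal' _ _).mp hw _ h4
    rw [inner_sub_right, hs', zero_sub, neg_eq_zero] at this
    exact this
  rw [inner_self_eq_zero] at h5
  rw [← hFw, h5, map_zero] at hv
  exact hv rfl

/-- A quotient of a unitary representation whose invariants are spanned by one vector is the sum
of the line of invariants and of the images of the operators. -/
theorem mem_span_of_unitary (adj : ∀ x u v, inner ℂ (σ (st x) u) v = inner ℂ u (σ x v))
    (hF : ∀ x v, F (σ x v) = L x (F v)) (v : E)
    (huniq : ∀ u, (∀ x, L x (F u) = 0) → ∃ c : ℂ, F u = c • F v) (u : E) :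
    ∃ c : ℂ, F u - c • F v ∈ Submodule.span ℂ {b | ∃ x u, b = L x (F u)} := by
  obtain ⟨S, hSdef⟩ : ∃ S, S = Submodule.span ℂ {b | ∃ x u, b = σ x u} := ⟨_, rfl⟩
  have hS : ∀ x u, σ x u ∈ S := fun x u => hSdef ▸ Submodule.subset_span ⟨x, u, rfl⟩
  have hSF : ∀ s ∈ S, F s ∈ Submodule.span ℂ {b | ∃ x u, b = L x (F u)} := by
    have : S ≤ (Submodule.span ℂ {b | ∃ x u, b = L x (F u)}).comap F := by
      rw [hSdef]
      refine Submodule.span_le.mpr ?_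
      rintro _ ⟨x, u, rfl⟩
      exact Submodule.subset_span ⟨x, u, hF x u⟩
    exact fun s hs => this hs
  obtain ⟨Q, hQdef⟩ : ∃ Q, Q = LinearMap.ker F ⊔ Submodule.span ℂ {v} ⊔ S := ⟨_, rfl⟩
  have hQ : Qᗮ = ⊥ := by
    rw [Submodule.eq_bot_iff]
    intro z hz
    have hz' : ∀ q ∈ Q, inner ℂ q z = (0 : ℂ) := (Submodule.mem_orthogonal _ _).mp hz
    have hσz : ∀ x, σ x z = 0 := fun x => by
      have h : inner ℂ (σ x z) (σ x z) = (0 : ℂ) := by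
        rw [← adj, hz' _ (hQdef ▸ Submodule.mem_sup_right (hS _ _))]
      exact inner_self_eq_zero.mp h
    obtain ⟨c, hc⟩ := huniq z fun x => by rw [← hF, hσz, map_zero]
    have hzQ : z ∈ Q := by
      have h1 : z - c • v ∈ LinearMap.ker F := by
        rw [LinearMap.mem_ker, map_sub, map_smul, hc, sub_self]
      have h2 : c • v ∈ Submodule.span ℂ {v} :=
        Submodule.smul_mem _ _ (Submodule.mem_span_singleton_self v)
      have := Submodule.add_mem_sup h1 h2
      rw [sub_add_cancel] at this
      exact hQdef ▸ Submodule.mem_sup_left this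
    exact inner_self_eq_zero.mp (hz' _ hzQ)
  have hu : u ∈ LinearMap.ker F ⊔ Submodule.span ℂ {v} ⊔ S := by
    rw [← hQdef, (Submodule.orthogonal_eq_bot_iff).mp hQ]
    exact Submodule.mem_top
  obtain ⟨y, hy, s, hs, hys⟩ := Submodule.mem_sup.mp hu
  obtain ⟨k, hk, z, hz, hkz⟩ := Submodule.mem_sup.mp hy
  obtain ⟨c, hc⟩ := Submodule.mem_span_singleton.mp hz
  refine ⟨c, ?_⟩
  have h : F u - c • F v = F s := by
    rw [← hys, ← hkz, ← hc, map_add, map_add, LinearMap.mem_ker.mp hk, map_smul, zero_add,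
      add_sub_cancel_left]
  rw [h]
  exact hSF s hs

end Unitary

/-! ### Unitary families of forms -/

section Families

attribute [local instance 100] LieRing.ofAssociativeRing

variable {m n : ℕ}

/-- An element of the even part, as an element of `sl(m|n)`. -/
def evenToSl (x : slEven m n) : sl m n := ⟨x.1, x.2.2⟩

theorem evenToSl_mem (x : slEven m n) : (evenToSl x).1 ∈ Mat.part m n 0 := x.2.1

/-- The conjugate transpose of an element of the even part. -/
def evenStar (x : slEven m n) : slEven m n :=
  ⟨x.1.conjTranspose, fun a b h => by
    rw [Matrix.conjTranspose_apply, x.2.1 b a (by rwa [add_comm]), star_zero], by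
    have h : str m n x.1 = 0 := x.2.2
    change str m n _ = 0
    rw [← star_eq_zero, ← h]
    simp only [str, LinearMap.coe_mk, AddHom.coe_mk, star_sum, star_mul', Matrix.conjTranspose_apply,
      star_star]
    refine Finset.sum_congr rfl fun a _ => ?_
    rcases zmod2 (par a) with h | h <;> simp [h, psign]⟩

/-- A finite family of elements of `A` on whose span the even part acts by left translations in a
unitary way, i.e. conjugate transposed elements act by conjugate transposed matrices. -/
def IsUnitaryFamily {κ : Type} [Fintype κ] (f : κ → Module.Dual ℂ (U m n)) : Prop :=
  (∀ i, f i ∈ A m n) ∧ ∃ ρ : slEven m n → Matrix κ κ ℂ, ∀ x : slEven m n,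
    (∀ i, leftTr (U.ι (evenToSl x)) (f i) = ∑ j, ρ x i j • f j) ∧ ρ (evenStar x) = (ρ x).conjTranspose

/-- A subspace of `A` spanned by a unitary family. -/
def IsUnitarySpace (W : Submodule ℂ (Module.Dual ℂ (U m n))) : Prop :=
  ∃ (κ : Type) (_ : Fintype κ) (f : κ → Module.Dual ℂ (U m n)), IsUnitaryFamily f ∧
    W = Submodule.span ℂ (Set.range f)

theorem IsUnitarySpace.sup {V W : Submodule ℂ (Module.Dual ℂ (U m n))} (hV : IsUnitarySpace V)
    (hW : IsUnitarySpace W) : IsUnitarySpace (V ⊔ W) := by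
  obtain ⟨κ, _, f, ⟨hf, ρ, hρ⟩, rfl⟩ := hV
  obtain ⟨κ', _, g, ⟨hg, ρ', hρ'⟩, rfl⟩ := hW
  refine ⟨κ ⊕ κ', inferInstance, Sum.elim f g, ⟨?_, fun x => Matrix.fromBlocks (ρ x) 0 0 (ρ' x),
    fun x => ⟨?_, ?_⟩⟩, ?_⟩
  · rintro (i | i)
    exacts [hf i, hg i]
  · rintro (i | i)
    · simp [(hρ x).1]
    · simp [(hρ' x).1]
  · change Matrix.fromBlocks (ρ _) 0 0 (ρ' _) = (Matrix.fromBlocks _ 0 0 _).conjTranspose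
    rw [(hρ x).2, (hρ' x).2, Matrix.fromBlocks_conjTranspose]
    simp
  · rw [Set.Sum.elim_range, Submodule.span_union]

theorem IsUnitarySpace.mul {V W : Submodule ℂ (Module.Dual ℂ (U m n))} (hV : IsUnitarySpace V)
    (hW : IsUnitarySpace W) : IsUnitarySpace (V * W) := by
  classical
  obtain ⟨κ, _, f, ⟨hf, ρ, hρ⟩, rfl⟩ := hV
  obtain ⟨κ', _, g, ⟨hg, ρ', hρ'⟩, rfl⟩ := hW
  refine ⟨κ × κ', inferInstance, fun p => f p.1 * g p.2, ⟨fun p => (A m n).mul_mem (hf _) (hg _),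
    fun x => Matrix.of fun p q => (if p.2 = q.2 then ρ x p.1 q.1 else 0) +
      (if p.1 = q.1 then ρ' x p.2 q.2 else 0), fun x => ⟨fun p => ?_, ?_⟩⟩, ?_⟩
  · rw [leftTr_mul_even (evenToSl_mem x), (hρ x).1, (hρ' x).1, Fintype.sum_prod_type]
    simp [add_smul, Finset.sum_add_distrib, Finset.sum_mul, Finset.mul_sum]
  · ext p q
    change (if p.2 = q.2 then ρ (evenStar x) p.1 q.1 else 0) +
      (if p.1 = q.1 then ρ' (evenStar x) p.2 q.2 else 0) =
      star ((if q.2 = p.2 then ρ x q.1 p.1 else 0) + (if q.1 = p.1 then ρ' x q.2 p.2 else 0))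
    rw [(hρ x).2, (hρ' x).2, star_add]
    simp only [apply_ite star, star_zero, Matrix.conjTranspose_apply, eq_comm (a := p.1),
      eq_comm (a := p.2)]
  · rw [Submodule.span_mul_span]
    congr 1
    ext h
    simp [Set.mem_mul]

theorem isUnitarySpace_one : IsUnitarySpace (1 : Submodule ℂ (Module.Dual ℂ (U m n))) := by
  refine ⟨Unit, inferInstance, fun _ => 1, ⟨fun _ => (A m n).one_mem, fun _ => 0, fun x => ?_⟩, ?_⟩
  · simp [leftTr_one]
  · simp [Submodule.one_eq_span]

theorem exists_isUnitarySpace {a : Module.Dual ℂ (U m n)} (ha : a ∈ A m n) :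
    ∃ W, IsUnitarySpace W ∧ a ∈ W := by
  induction ha using Algebra.adjoin_induction with
  | mem f hf =>
    rcases hf with ⟨⟨a, b⟩, rfl⟩ | ⟨⟨a, b⟩, rfl⟩
    · refine ⟨_, ⟨_, inferInstance, fun c => vecForm c b, ⟨fun c => (t c b).2, fun x => x.1,
        fun x => ⟨fun i => ?_, rfl⟩⟩, rfl⟩, Submodule.subset_span ⟨a, rfl⟩⟩
      rw [leftTr_vecForm, vecRep_ι]
      rfl
    · refine ⟨_, ⟨_, inferInstance, fun c => dualForm c b, ⟨fun c => (tbar c b).2,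
        fun x => negST m n x.1, fun x => ⟨fun i => ?_, ?_⟩⟩, rfl⟩, Submodule.subset_span ⟨a, rfl⟩⟩
      · rw [leftTr_dualForm, dualRep_ι]
        rfl
      · ext c d
        by_cases h : par c + par d = 0
        · simp [negST, evenStar, h, add_comm (par d), psign_zero]
        · have h1 := x.2.1 c d h
          simp [negST, evenStar, h1]
  | algebraMap r =>
    exact ⟨1, isUnitarySpace_one, Submodule.algebraMap_mem r⟩
  | add f g _ _ hf hg =>
    obtain ⟨V, hV, hf⟩ := hf
    obtain ⟨W, hW, hg⟩ := hg
    exact ⟨_, hV.sup hW, Submodule.add_mem_sup hf hg⟩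
  | mul f g _ _ hf hg =>
    obtain ⟨V, hV, hf⟩ := hf
    obtain ⟨W, hW, hg⟩ := hg
    exact ⟨_, hV.mul hW, Submodule.mul_mem_mul hf hg⟩

theorem exists_isUnitarySpace_one {a : Module.Dual ℂ (U m n)} (ha : a ∈ A m n) :
    ∃ W, IsUnitarySpace W ∧ a ∈ W ∧ 1 ∈ W := by
  obtain ⟨W, hW, h⟩ := exists_isUnitarySpace ha
  exact ⟨_, hW.sup isUnitarySpace_one, Submodule.mem_sup_left h,
    Submodule.mem_sup_right (Submodule.one_le.mp le_rfl)⟩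

/-- The left translation by `x` of linear forms on `U(sl(m|n)_0)`. -/
def leftTrE (x : slEven m n) : Module.Dual ℂ (Ue m n) →ₗ[ℂ] Module.Dual ℂ (Ue m n) :=
  (LinearMap.mulLeft ℂ (UniversalEnvelopingAlgebra.ι ℂ x)).dualMap

theorem incl_ι (x : slEven m n) :
    incl m n (UniversalEnvelopingAlgebra.ι ℂ x) = U.ι (evenToSl x) := by
  rw [incl, UniversalEnvelopingAlgebra.lift_ι_apply]
  rfl

theorem restr_leftTr (x : slEven m n) (f : Module.Dual ℂ (U m n)) :
    restr m n (leftTr (U.ι (evenToSl x)) f) = leftTrE x (restr m n f) := by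
  ext u
  change f (U.ι (evenToSl x) * incl m n u) = f (incl m n (UniversalEnvelopingAlgebra.ι ℂ x * u))
  rw [map_mul (incl m n), incl_ι]

theorem Ue.induction {p : Ue m n → Prop} (h1 : p 1) (hadd : ∀ u v, p u → p v → p (u + v))
    (hsmul : ∀ (c : ℂ) u, p u → p (c • u))
    (hι : ∀ (x : slEven m n) u, p u → p (UniversalEnvelopingAlgebra.ι ℂ x * u))
    (u : Ue m n) : p u := by
  let S : Subalgebra ℂ (Ue m n) :=
    { carrier := {v | ∀ u, p u → p (v * u)}
      mul_mem' := fun {a b} ha hb u hu => by rw [mul_assoc]; exact ha _ (hb _ hu)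
      add_mem' := fun {a b} ha hb u hu => by rw [add_mul]; exact hadd _ _ (ha _ hu) (hb _ hu)
      algebraMap_mem' := fun r u hu => by
        rw [← Algebra.smul_def]; exact hsmul _ _ hu }
  let φ : slEven m n →ₗ⁅ℂ⁆ S :=
    { toFun := fun x => ⟨UniversalEnvelopingAlgebra.ι ℂ x, hι x⟩
      map_add' := fun x y => Subtype.ext (map_add _ x y)
      map_smul' := fun c x => Subtype.ext (map_smul _ c x)
      map_lie' := fun {x y} => Subtype.ext (LieHom.map_lie _ x y) }
  let f : Ue m n →ₐ[ℂ] S := UniversalEnvelopingAlgebra.lift ℂ φ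
  have hf : S.val.comp f = AlgHom.id ℂ _ := by
    apply UniversalEnvelopingAlgebra.hom_ext
    ext x
    simp only [f, LieHom.coe_comp, Function.comp_apply, AlgHom.coe_toLieHom, AlgHom.comp_apply,
      UniversalEnvelopingAlgebra.lift_ι_apply]
    rfl
  have : (S.val (f u)) = u := AlgHom.congr_fun hf u
  have hu : u ∈ S := this ▸ (f u).2
  simpa using hu 1 h1

theorem Ue.counit_ι_mul (x : slEven m n) (u : Ue m n) :
    Ue.counit m n (UniversalEnvelopingAlgebra.ι ℂ x * u) = 0 := by
  simp [Ue.counit]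

/-- The forms on `U(sl(m|n)_0)` invariant under left translations are the multiples of the
counit. -/
theorem eq_smul_counit {g : Module.Dual ℂ (Ue m n)} (hg : ∀ x, leftTrE x g = 0) :
    g = g 1 • (Ue.counit m n).toLinearMap := by
  ext u
  induction u using Ue.induction with
  | h1 => simp
  | hadd u v hu hv => rw [map_add, hu, hv, map_add]
  | hsmul c u hu => rw [map_smul, hu, map_smul]
  | hι x u hu =>
    have := LinearMap.congr_fun (hg x) u
    rw [LinearMap.smul_apply, AlgHom.toLinearMap_apply, Ue.counit_ι_mul, smul_zero]
    exact this

/-- The realization of a unitary space as a quotient of a unitary representation on a Euclidean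
space, restricted to the even part. -/
theorem IsUnitarySpace.exists_euclidean {W : Submodule ℂ (Module.Dual ℂ (U m n))}
    (hW : IsUnitarySpace W) : ∃ (κ : Type) (_ : Fintype κ)
      (σ : slEven m n → EuclideanSpace ℂ κ →ₗ[ℂ] EuclideanSpace ℂ κ)
      (F : EuclideanSpace ℂ κ →ₗ[ℂ] Module.Dual ℂ (Ue m n)),
      (∀ x u v, inner ℂ (σ (evenStar x) u) v = inner ℂ u (σ x v)) ∧
      (∀ x v, F (σ x v) = leftTrE x (F v)) ∧ LinearMap.range F = W.map (restr m n) := by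
  classical
  obtain ⟨κ, _, f, ⟨hf, ρ, hρ⟩, rfl⟩ := hW
  refine ⟨κ, inferInstance, fun x => Matrix.toEuclideanLin (ρ x).transpose,
    restr m n ∘ₗ Fintype.linearCombination ℂ f ∘ₗ (WithLp.linearEquiv 2 ℂ (κ → ℂ)).toLinearMap,
    fun x u v => ?_, fun x v => ?_, ?_⟩
  · have h : (ρ (evenStar x)).transpose = (ρ x).transpose.conjTranspose := by rw [(hρ x).2]; rfl
    change inner ℂ (Matrix.toEuclideanLin (ρ (evenStar x)).transpose u) v =
      inner ℂ u (Matrix.toEuclideanLin (ρ x).transpose v)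
    rw [h, Matrix.toEuclideanLin_conjTranspose_eq_adjoint, LinearMap.adjoint_inner_left]
  · simp only [LinearMap.comp_apply]
    rw [← restr_leftTr]
    congr 1
    simp only [Fintype.linearCombination_apply, map_sum, map_smul, (hρ x).1, Finset.smul_sum]
    rw [Finset.sum_comm]
    refine Finset.sum_congr rfl fun j _ => ?_
    simp [Matrix.toLpLin_apply, Matrix.mulVec, dotProduct, Finset.sum_smul, smul_smul,
      mul_comm]
  · rw [LinearMap.range_comp, LinearMap.range_comp_of_range_eq_top _ (LinearEquiv.range _),
      Fintype.range_linearCombination]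

/-- The left translates `a(x ·)` of elements of `A_e` by elements `x` of the even part. -/
def translatesE (m n : ℕ) : Submodule ℂ (Module.Dual ℂ (Ue m n)) :=
  Submodule.span ℂ {b | ∃ x, ∃ a ∈ Ae m n, b = leftTrE x a}

theorem counit_notMem : (Ue.counit m n).toLinearMap ∉ translatesE m n := by
  -- elements of `translatesE` only involve a finite part of `A`
  have key : ∀ b ∈ translatesE m n, ∃ W, IsUnitarySpace W ∧ (1 : Module.Dual ℂ (U m n)) ∈ W ∧
      b ∈ Submodule.span ℂ {b | ∃ x, ∃ a ∈ W.map (restr m n), b = leftTrE x a} := by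
    intro b hb
    induction hb using Submodule.span_induction with
    | mem b hb =>
      obtain ⟨x, _, ⟨a, ha, rfl⟩, rfl⟩ := hb
      obtain ⟨W, hW, haW, h1⟩ := exists_isUnitarySpace_one ha
      exact ⟨W, hW, h1, Submodule.subset_span ⟨x, _, ⟨a, haW, rfl⟩, rfl⟩⟩
    | zero =>
      exact ⟨1, isUnitarySpace_one, (Submodule.one_le.mp le_rfl), Submodule.zero_mem _⟩
    | add a b _ _ ha hb =>
      obtain ⟨V, hV, h1, ha⟩ := ha
      obtain ⟨W, hW, -, hb⟩ := hb
      refine ⟨_, hV.sup hW, Submodule.mem_sup_left h1, Submodule.add_mem _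
        (Submodule.span_mono ?_ ha) (Submodule.span_mono ?_ hb)⟩
      · rintro _ ⟨x, a, ha, rfl⟩
        exact ⟨x, a, Submodule.map_mono le_sup_left ha, rfl⟩
      · rintro _ ⟨x, a, ha, rfl⟩
        exact ⟨x, a, Submodule.map_mono le_sup_right ha, rfl⟩
    | smul c b _ hb =>
      obtain ⟨W, hW, h1, hb⟩ := hb
      exact ⟨W, hW, h1, Submodule.smul_mem _ _ hb⟩
  intro h
  obtain ⟨W, hW, h1, hb⟩ := key _ h
  obtain ⟨κ, _, σ, F, adj, hF, hr⟩ := hW.exists_euclidean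
  have h2 : (Ue.counit m n).toLinearMap ∈ LinearMap.range F := by
    rw [hr]; exact ⟨1, h1, counit_incl m n⟩
  obtain ⟨v, hv⟩ := h2
  refine notMem_span_of_unitary (L := leftTrE) adj hF (v := v) ?_ ?_ ?_
  · rw [hv]
    intro h0
    simpa using LinearMap.congr_fun h0 1
  · intro x
    rw [hv]
    ext u
    exact Ue.counit_ι_mul x u
  · rw [hv]
    refine Submodule.span_mono ?_ hb
    rintro _ ⟨x, a, ha, rfl⟩
    rw [← hr] at ha
    obtain ⟨u, rfl⟩ := ha
    exact ⟨x, u, rfl⟩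

theorem exists_sub_mem_translatesE {a : Module.Dual ℂ (Ue m n)} (ha : a ∈ Ae m n) :
    ∃ c : ℂ, a - c • (Ue.counit m n).toLinearMap ∈ translatesE m n := by
  obtain ⟨f, hf, rfl⟩ := ha
  obtain ⟨W, hW, hfW, h1⟩ := exists_isUnitarySpace_one hf
  obtain ⟨κ, _, σ, F, adj, hF, hr⟩ := hW.exists_euclidean
  have h2 : (Ue.counit m n).toLinearMap ∈ LinearMap.range F := by
    rw [hr]; exact ⟨1, h1, counit_incl m n⟩
  have h3 : restr m n f ∈ LinearMap.range F := by
    rw [hr]; exact ⟨f, hfW, rfl⟩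
  obtain ⟨v, hv⟩ := h2
  obtain ⟨u, hu⟩ := h3
  obtain ⟨c, hc⟩ := mem_span_of_unitary (L := leftTrE) adj hF v
    (fun u h => ⟨_, (eq_smul_counit h).trans (by rw [hv])⟩) u
  refine ⟨c, ?_⟩
  rw [hu, hv] at hc
  refine Submodule.span_mono ?_ hc
  rintro _ ⟨x, u, rfl⟩
  refine ⟨x, F u, ?_, rfl⟩
  have : F u ∈ W.map (restr m n) := hr ▸ ⟨u, rfl⟩
  obtain ⟨g, hg, h⟩ := this
  rw [← h]
  refine ⟨g, ?_, rfl⟩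
  obtain ⟨κ', _, f', ⟨hf', _⟩, rfl⟩ := hW
  refine Submodule.span_le.mpr ?_ hg
  rintro _ ⟨i, rfl⟩
  exact hf' i

end Families


/-! ### Integrals in terms of translations -/

section Slices

variable {B S : Type*} [Ring B] [Algebra ℂ B] [AddCommGroup S] [Module ℂ S]
  {π : B →ₗ[ℂ] B} {πS : S →ₗ[ℂ] S} {j : S →ₗ[ℂ] Module.Dual ℂ B} {I : Module.Dual ℂ S}

theorem formEven_of_even (hI : ∀ s, I (πS s) = I s) : formEven πS I = I := by
  ext s; rw [formEven_apply, hI]; ring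

theorem formOdd_of_even (hI : ∀ s, I (πS s) = I s) : formOdd πS I = 0 := by
  ext s; rw [formOdd_apply, hI, sub_self, mul_zero]; rfl

/-- For an even form `I`, the value at `y` of `(id ⊗ I)(T)` is `I` applied to the slice of `T`
at `y` in the first tensor factor. -/
theorem idTensor_slice (hj : Function.Injective j) (hπ : ∀ s, j (πS s) = j s ∘ₗ π)
    (hI : ∀ s, I (πS s) = I s) (T : S ⊗[ℂ] S) (y : B) (a : S)
    (ha : ∀ z, gradedPairing π (TensorProduct.map j j T) (y ⊗ₜ z) = j a z) :
    j (idTensor πS I T) y = I a := by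
  let ev (y : B) : S →ₗ[ℂ] ℂ := LinearMap.applyₗ y ∘ₗ j
  let σ : S ⊗[ℂ] S →ₗ[ℂ] S := (TensorProduct.lid ℂ S).toLinearMap ∘ₗ
    (TensorProduct.map (ev y) ((2⁻¹ : ℂ) • (LinearMap.id + πS)) +
      TensorProduct.map (ev (π y)) ((2⁻¹ : ℂ) • (LinearMap.id - πS)))
  have h1 : ∀ T z, j (σ T) z = gradedPairing π (TensorProduct.map j j T) (y ⊗ₜ z) := by
    intro T z
    induction T with
    | zero => simp
    | add T T' h h' => simp only [map_add, LinearMap.add_apply, h, h']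
    | tmul p q =>
      rw [TensorProduct.map_tmul, gradedPairing_tmul, formEven_apply, formOdd_apply]
      simp [σ, ev, hπ]
      ring
  have h2 : ∀ T, I (σ T) = j (idTensor πS I T) y := by
    intro T
    induction T with
    | zero => simp
    | add T T' h h' => simp only [map_add, LinearMap.add_apply, h, h']
    | tmul p q =>
      rw [idTensor, formEven_of_even hI, formOdd_of_even hI]
      simp [σ, ev, hI]
      ring
  have h3 : σ T = a := hj (LinearMap.ext fun z => (h1 T z).trans (ha z))
  rw [← h2, h3]

/-- For an even form `I`, the value at `y` of `(I ⊗ id)(T)` is `I` applied to the slice of `T`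
at `y` in the second tensor factor. -/
theorem tensorId_slice (hj : Function.Injective j) (hπ : ∀ s, j (πS s) = j s ∘ₗ π)
    (hI : ∀ s, I (πS s) = I s) (T : S ⊗[ℂ] S) (y : B) (a : S)
    (ha : ∀ z, gradedPairing π (TensorProduct.map j j T) (z ⊗ₜ y) = j a z) :
    j (tensorId I T) y = I a := by
  let ev (y : B) : S →ₗ[ℂ] ℂ := LinearMap.applyₗ y ∘ₗ j
  let σ : S ⊗[ℂ] S →ₗ[ℂ] S := (TensorProduct.rid ℂ S).toLinearMap ∘ₗ
    (TensorProduct.map LinearMap.id ((2⁻¹ : ℂ) • (ev y + ev (π y))) +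
      TensorProduct.map πS ((2⁻¹ : ℂ) • (ev y - ev (π y))))
  have h1 : ∀ T z, j (σ T) z = gradedPairing π (TensorProduct.map j j T) (z ⊗ₜ y) := by
    intro T z
    induction T with
    | zero => simp
    | add T T' h h' => simp only [map_add, LinearMap.add_apply, h, h']
    | tmul p q =>
      rw [TensorProduct.map_tmul, gradedPairing_tmul, formEven_apply, formOdd_apply]
      simp [σ, ev, hπ]
      ring
  have h2 : ∀ T, I (σ T) = j (tensorId I T) y := by
    intro T
    induction T with
    | zero => simp
    | add T T' h h' => simp only [map_add, LinearMap.add_apply, h, h']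
    | tmul p q =>
      simp [σ, ev, hI, tensorId]
      ring
  have h3 : σ T = a := hj (LinearMap.ext fun z => (h1 T z).trans (ha z))
  rw [← h2, h3]

theorem gradedPairing_even (hI : ∀ s, I (πS s) = I s) (T : S ⊗[ℂ] S) (y : B)
    (f : Module.Dual ℂ S) (hf : ∀ s, f s = j s y) :
    gradedPairing πS (f ⊗ₜ I) T = j (idTensor πS I T) y := by
  induction T with
  | zero => simp
  | add T T' h h' => simp only [map_add, LinearMap.add_apply, h, h']
  | tmul p q =>
    rw [gradedPairing_tmul, idTensor, formEven_of_even hI, formOdd_of_even hI]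
    simp [hf, mul_comm]

end Slices

section Translations

attribute [local instance 100] LieRing.ofAssociativeRing

variable {m n : ℕ}

/-- The translate `a ↦ a(y · z)` of linear forms on an algebra. -/
def biTr {B : Type*} [Ring B] [Algebra ℂ B] (y z : B) :
    Module.Dual ℂ B →ₗ[ℂ] Module.Dual ℂ B :=
  (LinearMap.mulLeft ℂ y ∘ₗ LinearMap.mulRight ℂ z).dualMap

theorem biTr_apply {B : Type*} [Ring B] [Algebra ℂ B] (y z u : B) (f : Module.Dual ℂ B) :
    biTr y z f u = f (y * (u * z)) := rfl

theorem biTr_mem_A (y z : U m n) {f : Module.Dual ℂ (U m n)} (hf : f ∈ A m n) :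
    biTr y z f ∈ A m n := by
  obtain ⟨ι, _, p, q, hp, hq, h⟩ := A_split hf
  have e : biTr y z f = ∑ i, p i y • biTr 1 z (q i) := by
    ext u
    simp [biTr_apply, h]
  rw [e]
  refine (A m n).sum_mem fun i _ => (A m n).smul_mem ?_ _
  obtain ⟨ι', _, p', q', hp', hq', h'⟩ := A_split (hq i)
  have e' : biTr 1 z (q i) = ∑ k, q' k z • p' k := by
    ext u
    simp [biTr_apply, h', mul_comm]
  rw [e']
  exact (A m n).sum_mem fun k _ => (A m n).smul_mem (hp' k) _

/-- The translate `a(y · z)` of an element of `A`. -/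
def A.tr (y z : U m n) (a : A m n) : A m n := ⟨biTr y z a.1, biTr_mem_A y z a.2⟩

theorem biTr_mem_Ae (y z : Ue m n) {f : Module.Dual ℂ (Ue m n)} (hf : f ∈ Ae m n) :
    biTr y z f ∈ Ae m n := by
  obtain ⟨f, hf, rfl⟩ := hf
  refine ⟨biTr (incl m n y) (incl m n z) f, biTr_mem_A _ _ hf, ?_⟩
  ext u
  simp [restr, biTr_apply]

/-- The translate `a(y · z)` of an element of `A_e`. -/
def Ae.tr (y z : Ue m n) (a : Ae m n) : Ae m n := ⟨biTr y z a.1, biTr_mem_Ae y z a.2⟩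

theorem P_tr (y z : Ue m n) (a : A m n) :
    P m n (A.tr (incl m n y) (incl m n z) a) = Ae.tr y z (P m n a) := by
  apply Subtype.ext
  ext u
  simp [P, A.tr, Ae.tr, restr, biTr_apply]

theorem incl_parity (u : Ue m n) : U.π m n (incl m n u) = incl m n u := by
  induction u using Ue.induction with
  | h1 => simp [U.π]
  | hadd u v hu hv => rw [map_add, map_add, hu, hv]
  | hsmul c u hu => rw [map_smul, map_smul, hu]
  | hι x u hu =>
    have h : U.parity m n (U.ι (evenToSl x)) = U.ι (evenToSl x) := by
      simpa [psign_zero] using U.parity_ι (evenToSl_mem x)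
    rw [map_mul (incl m n), incl_ι]
    simp only [U.π, AlgHom.toLinearMap_apply] at hu ⊢
    rw [map_mul, h, hu]

theorem P_π (a : A m n) : P m n (A.π m n a) = P m n a := by
  apply Subtype.ext
  ext u
  change a.1 (U.π m n (incl m n u)) = a.1 (incl m n u)
  rw [incl_parity]

theorem π_Γ : U.π m n (Γ m n) = Γ m n := by
  have h1 := oddFamily_oddE.π_prod (orderE m n)
  have h2 := oddFamily_oddF.π_prod (orderE m n).reverse
  simp only [U.π, AlgHom.toLinearMap_apply] at h1 h2 ⊢
  rw [Γ_eq, map_mul, h1, h2, List.length_reverse, smul_mul_smul_comm, ← mul_pow]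
  simp

theorem incl_mul_Γ (u : Ue m n) : incl m n u * Γ m n = Γ m n * incl m n u := by
  induction u using Ue.induction with
  | h1 => simp
  | hadd u v hu hv => rw [map_add, add_mul, mul_add, hu, hv]
  | hsmul c u hu => rw [map_smul, smul_mul_assoc, mul_smul_comm, hu]
  | hι x u hu =>
    rw [map_mul (incl m n), incl_ι, mul_assoc, hu, ← mul_assoc, ι_mul_Γ (evenToSl_mem x),
      mul_assoc]

end Translations

/-! ### The integral on the even part -/

section EvenIntegral

attribute [local instance 100] LieRing.ofAssociativeRing

variable {m n : ℕ} {I₀ : Module.Dual ℂ (Ae m n)}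

theorem Ae.comul_apply (a : Ae m n) (y z : Ue m n) :
    gradedPairing LinearMap.id (TensorProduct.map (Ae m n).subtype (Ae m n).subtype
      (Ae.comul m n a)) (y ⊗ₜ z) = a.1 (y * z) :=
  comulOf_spec _ _ _ _ _ _ _ _

theorem idTensor_Ae (a : Ae m n) (y : Ue m n) :
    (idTensor LinearMap.id I₀ (Ae.comul m n a)).1 y = I₀ (Ae.tr y 1 a) :=
  idTensor_slice (π := LinearMap.id) (j := (Ae m n).subtype) Subtype.val_injective
    (fun _ => rfl) (fun _ => rfl) _ _ _ fun z => by
      rw [Ae.comul_apply]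
      simp [Ae.tr, biTr_apply]

theorem isLeftIntegral_Ae_iff :
    IsLeftIntegral LinearMap.id (Ae.comul m n) (Ae.one m n) I₀ ↔
      ∀ (x : slEven m n) (a : Ae m n), I₀ (Ae.tr (UniversalEnvelopingAlgebra.ι ℂ x) 1 a) = 0 := by
  constructor
  · intro h x a
    rw [← idTensor_Ae, h a]
    change I₀ a * Ue.counit m n _ = 0
    rw [← mul_one (UniversalEnvelopingAlgebra.ι ℂ x), Ue.counit_ι_mul, mul_zero]
  · intro h a
    apply Subtype.ext
    ext y
    rw [idTensor_Ae]
    change _ = I₀ a * Ue.counit m n y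
    induction y using Ue.induction generalizing a with
    | h1 =>
      have : Ae.tr 1 1 a = a := Subtype.ext (LinearMap.ext fun u => by simp [Ae.tr, biTr_apply])
      rw [this, map_one, mul_one]
    | hadd u v hu hv =>
      have : Ae.tr (u + v) 1 a = Ae.tr u 1 a + Ae.tr v 1 a :=
        Subtype.ext (LinearMap.ext fun u => by simp [Ae.tr, biTr_apply, add_mul])
      rw [this, map_add, hu, hv, map_add, mul_add]
    | hsmul c u hu =>
      have : Ae.tr (c • u) 1 a = c • Ae.tr u 1 a :=
        Subtype.ext (LinearMap.ext fun u => by simp [Ae.tr, biTr_apply])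
      rw [this, map_smul, hu, map_smul, smul_eq_mul, smul_eq_mul]
      ring
    | hι x u hu =>
      have : Ae.tr (UniversalEnvelopingAlgebra.ι ℂ x * u) 1 a =
          Ae.tr u 1 (Ae.tr (UniversalEnvelopingAlgebra.ι ℂ x) 1 a) :=
        Subtype.ext (LinearMap.ext fun v => by simp only [Ae.tr, biTr_apply, mul_one, mul_assoc])
      rw [this, hu, h, Ue.counit_ι_mul, zero_mul, mul_zero]

theorem leftTrE_eq (x : slEven m n) (a : Module.Dual ℂ (Ue m n)) :
    leftTrE x a = biTr (UniversalEnvelopingAlgebra.ι ℂ x) 1 a := by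
  ext u
  rw [biTr_apply, mul_one]
  rfl

theorem exists_normalizedIntegral :
    ∃ I₀ : Module.Dual ℂ (Ae m n), IsNormalizedIntegral m n I₀ := by
  obtain ⟨φ, hφ, hker⟩ := Submodule.exists_le_ker_of_notMem (counit_notMem (m := m) (n := n))
  refine ⟨(φ (Ue.counit m n).toLinearMap)⁻¹ • φ ∘ₗ (Ae m n).subtype,
    isLeftIntegral_Ae_iff.mpr fun x a => ?_, inv_mul_cancel₀ hφ⟩
  have : φ (Ae.tr (UniversalEnvelopingAlgebra.ι ℂ x) 1 a).1 = 0 :=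
    hker (Submodule.subset_span ⟨x, a.1, a.2, (leftTrE_eq x a.1).symm⟩)
  change _ * φ (Ae.tr (UniversalEnvelopingAlgebra.ι ℂ x) 1 a).1 = 0
  rw [this, mul_zero]

theorem apply_of_mem_translatesE (hI : IsNormalizedIntegral m n I₀)
    {b : Module.Dual ℂ (Ue m n)} (hb : b ∈ translatesE m n) :
    ∃ h : b ∈ Ae m n, I₀ ⟨b, h⟩ = 0 := by
  induction hb using Submodule.span_induction with
  | mem b hb =>
    obtain ⟨x, a, ha, rfl⟩ := hb
    rw [leftTrE_eq]
    exact ⟨biTr_mem_Ae _ _ ha, isLeftIntegral_Ae_iff.mp hI.1 x ⟨a, ha⟩⟩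
  | zero => exact ⟨Submodule.zero_mem _, map_zero I₀⟩
  | add a b _ _ ha hb =>
    obtain ⟨ha, ha'⟩ := ha
    obtain ⟨hb, hb'⟩ := hb
    refine ⟨Submodule.add_mem _ ha hb, ?_⟩
    rw [← add_zero (0 : ℂ)]
    nth_rewrite 1 [← ha']
    rw [← hb', ← map_add]
    rfl
  | smul c b _ hb =>
    obtain ⟨hb, hb'⟩ := hb
    refine ⟨Submodule.smul_mem _ c hb, ?_⟩
    rw [← mul_zero c, ← hb', ← smul_eq_mul, ← map_smul]
    rfl

theorem normalizedIntegral_unique {I₁ : Module.Dual ℂ (Ae m n)}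
    (hI : IsNormalizedIntegral m n I₀) (hI₁ : IsNormalizedIntegral m n I₁) : I₀ = I₁ := by
  ext a
  obtain ⟨c, hc⟩ := exists_sub_mem_translatesE a.2
  have key : ∀ I : Module.Dual ℂ (Ae m n), IsNormalizedIntegral m n I → I a = c := by
    intro I hI
    obtain ⟨h, h'⟩ := apply_of_mem_translatesE hI hc
    have e : (⟨_, h⟩ : Ae m n) = a - c • Ae.one m n := rfl
    rw [e, map_sub, map_smul, hI.2, smul_eq_mul, mul_one, sub_eq_zero] at h'
    exact h'
  rw [key _ hI, key _ hI₁]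

/-- The integral on `A_e` is also invariant under right translations, since these commute with the
left ones and kill the invariants. -/
theorem apply_right_tr (hI : IsNormalizedIntegral m n I₀) (x : slEven m n) (a : Ae m n) :
    I₀ (Ae.tr 1 (UniversalEnvelopingAlgebra.ι ℂ x) a) = 0 := by
  obtain ⟨c, hc⟩ := exists_sub_mem_translatesE a.2
  have h1 : ∀ b ∈ translatesE m n,
      biTr 1 (UniversalEnvelopingAlgebra.ι ℂ x) b ∈ translatesE m n := by
    intro b hb
    have : translatesE m n ≤
        (translatesE m n).comap (biTr 1 (UniversalEnvelopingAlgebra.ι ℂ x)) := by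
      refine Submodule.span_le.mpr ?_
      rintro _ ⟨y, b, hb, rfl⟩
      refine Submodule.subset_span ⟨y, biTr 1 (UniversalEnvelopingAlgebra.ι ℂ x) b,
        biTr_mem_Ae _ _ hb, ?_⟩
      ext u
      simp only [leftTrE_eq, biTr_apply]
      simp only [one_mul, mul_one, mul_assoc]
    exact this hb
  have h2 := h1 _ hc
  have h3 : biTr 1 (UniversalEnvelopingAlgebra.ι ℂ x) (Ue.counit m n).toLinearMap = 0 := by
    ext u
    simp only [biTr_apply, AlgHom.toLinearMap_apply, map_mul, LinearMap.zero_apply]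
    have := Ue.counit_ι_mul x 1
    rw [mul_one] at this
    rw [this, mul_zero, mul_zero]
  rw [map_sub, map_smul, h3, smul_zero, sub_zero] at h2
  exact (apply_of_mem_translatesE hI h2).2

end EvenIntegral

/-! ### The integral on `A` -/

section SuperIntegral

attribute [local instance 100] LieRing.ofAssociativeRing

variable {m n : ℕ} {I₀ : Module.Dual ℂ (Ae m n)}

theorem A.comul_apply (a : A m n) (y z : U m n) :
    gradedPairing (U.π m n) (TensorProduct.map (A m n).val.toLinearMap (A m n).val.toLinearMap
      (A.comul m n a)) (y ⊗ₜ z) = a.1 (y * z) :=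
  comulOf_spec _ _ _ _ _ _ _ _

theorem idTensor_A {J : Module.Dual ℂ (A m n)} (hJ : ∀ a, J (A.π m n a) = J a) (a : A m n)
    (y : U m n) : (idTensor (A.π m n) J (A.comul m n a)).1 y = J (A.tr y 1 a) :=
  idTensor_slice (π := U.π m n) (j := (A m n).val.toLinearMap) Subtype.val_injective
    (fun _ => rfl) hJ _ _ _ fun z => by
      rw [A.comul_apply]
      simp [A.tr, biTr_apply]

theorem tensorId_A {J : Module.Dual ℂ (A m n)} (hJ : ∀ a, J (A.π m n a) = J a) (a : A m n)
    (y : U m n) : (tensorId J (A.comul m n a)).1 y = J (A.tr 1 y a) :=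
  tensorId_slice (π := U.π m n) (j := (A m n).val.toLinearMap) Subtype.val_injective
    (fun _ => rfl) hJ _ _ _ fun z => by
      rw [A.comul_apply]
      simp [A.tr, biTr_apply]

/-- The integral on `A` evaluates `I₀` on the restriction of `a(Γ ·)` to the even part. -/
theorem superIntegral_apply (a : A m n) :
    superIntegral m n I₀ a = I₀ (P m n (A.tr (Γ m n) 1 a)) := by
  have hΦ : ∀ a, (I₀ ∘ₗ P m n) (A.π m n a) = (I₀ ∘ₗ P m n) a := fun a => by
    rw [LinearMap.comp_apply, LinearMap.comp_apply, P_π]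
  rw [superIntegral, formMul, LinearMap.comp_apply,
    gradedPairing_even (j := (A m n).val.toLinearMap) hΦ _ (Γ m n) _ fun s => by
      change s.1 (U.π m n (Γ m n)) = _
      rw [π_Γ]; rfl]
  exact idTensor_A hΦ a (Γ m n)

theorem A.tr_tr (y z y' z' : U m n) (a : A m n) :
    A.tr y z (A.tr y' z' a) = A.tr (y' * y) (z * z') a := by
  apply Subtype.ext
  ext u
  simp only [A.tr, biTr_apply, mul_assoc]

theorem superIntegral_π (a : A m n) :
    superIntegral m n I₀ (A.π m n a) = superIntegral m n I₀ a := by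
  have e : A.tr (Γ m n) 1 (A.π m n a) = A.π m n (A.tr (Γ m n) 1 a) := by
    apply Subtype.ext
    ext u
    change a.1 (U.π m n (Γ m n * (u * 1))) = a.1 (Γ m n * (U.π m n u * 1))
    have := π_Γ (m := m) (n := n)
    simp only [U.π, AlgHom.toLinearMap_apply] at this ⊢
    rw [map_mul (U.parity m n), this, mul_one, mul_one]
  rw [superIntegral_apply, superIntegral_apply, e, P_π]

/-- `Γ` may equally well be placed on the right, since it commutes with the even part. -/
theorem P_tr_Γ (a : A m n) : P m n (A.tr (Γ m n) 1 a) = P m n (A.tr 1 (Γ m n) a) := by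
  apply Subtype.ext
  ext u
  change a.1 (Γ m n * (incl m n u * 1)) = a.1 (1 * (incl m n u * Γ m n))
  rw [mul_one, one_mul, incl_mul_Γ]

theorem apply_left_ideal (hI : IsNormalizedIntegral m n I₀) {w : U m n}
    (hw : w ∈ Ideal.span {b : U m n | ∃ y : sl m n, y.1 ∈ Mat.part m n 0 ∧ b = U.ι y})
    (a : A m n) : I₀ (P m n (A.tr w 1 a)) = 0 := by
  induction hw using Submodule.span_induction generalizing a with
  | mem b hb =>
    obtain ⟨y, hy, rfl⟩ := hb
    have h := isLeftIntegral_Ae_iff.mp hI.1 ⟨y.1, hy, y.2⟩ (P m n a)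
    rw [← P_tr, incl_ι, map_one] at h
    exact h
  | zero =>
    have : A.tr (0 : U m n) 1 a = 0 :=
      Subtype.ext (LinearMap.ext fun u => by simp [A.tr, biTr_apply])
    rw [this, map_zero, map_zero]
  | add w w' _ _ h h' =>
    have : A.tr (w + w') 1 a = A.tr w 1 a + A.tr w' 1 a :=
      Subtype.ext (LinearMap.ext fun u => by simp [A.tr, biTr_apply, add_mul])
    rw [this, map_add, map_add, h, h', add_zero]
  | smul r w _ h =>
    have : A.tr (r • w) 1 a = A.tr w 1 (A.tr r 1 a) := by rw [A.tr_tr, mul_one, smul_eq_mul]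
    rw [this, h]

open MulOpposite in
theorem apply_right_ideal (hI : IsNormalizedIntegral m n I₀) {w : (U m n)ᵐᵒᵖ}
    (hw : w ∈ Ideal.span {b | ∃ y : sl m n, y.1 ∈ Mat.part m n 0 ∧ b = op (U.ι y)})
    (a : A m n) : I₀ (P m n (A.tr 1 (unop w) a)) = 0 := by
  induction hw using Submodule.span_induction generalizing a with
  | mem b hb =>
    obtain ⟨y, hy, rfl⟩ := hb
    have h := apply_right_tr hI ⟨y.1, hy, y.2⟩ (P m n a)
    rw [← P_tr, incl_ι, map_one] at h
    exact h
  | zero =>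
    have : A.tr 1 (0 : U m n) a = 0 :=
      Subtype.ext (LinearMap.ext fun u => by simp [A.tr, biTr_apply])
    rw [unop_zero, this, map_zero, map_zero]
  | add w w' _ _ h h' =>
    have : A.tr 1 (unop w + unop w') a = A.tr 1 (unop w) a + A.tr 1 (unop w') a :=
      Subtype.ext (LinearMap.ext fun u => by simp [A.tr, biTr_apply, mul_add])
    rw [unop_add, this, map_add, map_add, h, h', add_zero]
  | smul r w _ h =>
    have : A.tr 1 (unop (r • w)) a = A.tr 1 (unop w) (A.tr 1 (unop r) a) := by
      rw [A.tr_tr, mul_one, smul_eq_mul, unop_mul]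
    rw [this, h]

theorem superIntegral_left (hI : IsNormalizedIntegral m n I₀) (x : sl m n) (a : A m n) :
    superIntegral m n I₀ (A.tr (U.ι x) 1 a) = 0 := by
  rw [superIntegral_apply, A.tr_tr, mul_one]
  exact apply_left_ideal hI (ι_mul_Γ_mem x) a

theorem superIntegral_right (hI : IsNormalizedIntegral m n I₀) (x : sl m n) (a : A m n) :
    superIntegral m n I₀ (A.tr 1 (U.ι x) a) = 0 := by
  rw [superIntegral_apply, P_tr_Γ, A.tr_tr, mul_one]
  exact apply_right_ideal hI (op_Γ_mul_ι_mem x) a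

theorem isLeftIntegral_superIntegral (hI : IsNormalizedIntegral m n I₀) :
    IsLeftIntegral (A.π m n) (A.comul m n) 1 (superIntegral m n I₀) := by
  intro a
  apply Subtype.ext
  ext y
  rw [idTensor_A superIntegral_π]
  change _ = superIntegral m n I₀ a * U.counit m n y
  induction y using U.induction generalizing a with
  | h1 =>
    have : A.tr 1 1 a = a := Subtype.ext (LinearMap.ext fun u => by simp [A.tr, biTr_apply])
    rw [this, map_one, mul_one]
  | hadd u v hu hv =>
    have : A.tr (u + v) 1 a = A.tr u 1 a + A.tr v 1 a :=
      Subtype.ext (LinearMap.ext fun u => by simp [A.tr, biTr_apply, add_mul])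
    rw [this, map_add, hu, hv, map_add, mul_add]
  | hsmul c u hu =>
    have : A.tr (c • u) 1 a = c • A.tr u 1 a :=
      Subtype.ext (LinearMap.ext fun u => by simp [A.tr, biTr_apply])
    rw [this, map_smul, hu, map_smul, smul_eq_mul, smul_eq_mul]
    ring
  | hι p x hx u hu =>
    have : A.tr (U.ι x * u) 1 a = A.tr u 1 (A.tr (U.ι x) 1 a) := by rw [A.tr_tr, mul_one]
    rw [this, hu, superIntegral_left hI]
    simp [U.counit, U.lift_ι]

theorem isRightIntegral_superIntegral (hI : IsNormalizedIntegral m n I₀) :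
    IsRightIntegral (A.comul m n) 1 (superIntegral m n I₀) := by
  intro a
  apply Subtype.ext
  ext y
  rw [tensorId_A superIntegral_π]
  change _ = superIntegral m n I₀ a * U.counit m n y
  induction y using U.induction with
  | h1 =>
    have : A.tr 1 1 a = a := Subtype.ext (LinearMap.ext fun u => by simp [A.tr, biTr_apply])
    rw [this, map_one, mul_one]
  | hadd u v hu hv =>
    have : A.tr 1 (u + v) a = A.tr 1 u a + A.tr 1 v a :=
      Subtype.ext (LinearMap.ext fun u => by simp [A.tr, biTr_apply, mul_add])
    rw [this, map_add, hu, hv, map_add, mul_add]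
  | hsmul c u hu =>
    have : A.tr 1 (c • u) a = c • A.tr 1 u a :=
      Subtype.ext (LinearMap.ext fun u => by simp [A.tr, biTr_apply])
    rw [this, map_smul, hu, map_smul, smul_eq_mul, smul_eq_mul]
    ring
  | hι p x hx u _ =>
    have : A.tr 1 (U.ι x * u) a = A.tr 1 (U.ι x) (A.tr 1 u a) := by rw [A.tr_tr, mul_one]
    rw [this, superIntegral_right hI]
    simp [U.counit, U.lift_ι]

theorem superIntegral_Θ (hI : IsNormalizedIntegral m n I₀) :
    superIntegral m n I₀ (Θ m n * Θbar m n) = (-1) ^ (m * n * (m * n + 1) / 2) := by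
  have h : P m n (A.tr (Γ m n) 1 (Θ m n * Θbar m n)) =
      ((Θ m n * Θbar m n).1 (Γ m n)) • Ae.one m n := by
    apply Subtype.ext
    refine (eq_smul_counit fun x => ?_).trans ?_
    · ext u
      have := LinearMap.congr_fun (leftTr_Θ_mul_Θbar (evenToSl_mem x)) (Γ m n * incl m n u)
      change (Θ m n * Θbar m n).1 (Γ m n * (incl m n (UniversalEnvelopingAlgebra.ι ℂ x * u) * 1)) = 0
      rw [mul_one, map_mul (incl m n), incl_ι, ← mul_assoc, ← ι_mul_Γ (evenToSl_mem x), mul_assoc]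
      exact this
    · congr 1
      change (Θ m n * Θbar m n).1 (Γ m n * (incl m n 1 * 1)) = _
      rw [map_one, mul_one, mul_one]
  rw [superIntegral_apply, h, map_smul, hI.2, Θ_mul_Θbar_Γ, smul_eq_mul, mul_one]

end SuperIntegral

end SuperInt

end

theorem theorem3 (m n : ℕ) :
    (∃! I₀ : Module.Dual ℂ (SuperInt.Ae m n), SuperInt.IsNormalizedIntegral m n I₀) ∧
    ∀ I₀ : Module.Dual ℂ (SuperInt.Ae m n), SuperInt.IsNormalizedIntegral m n I₀ →
      SuperInt.superIntegral m n I₀ ≠ 0 ∧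
      SuperInt.IsLeftIntegral (SuperInt.A.π m n) (SuperInt.A.comul m n) 1
        (SuperInt.superIntegral m n I₀) ∧
      SuperInt.IsRightIntegral (SuperInt.A.comul m n) 1 (SuperInt.superIntegral m n I₀) ∧
      SuperInt.superIntegral m n I₀ (SuperInt.Θ m n * SuperInt.Θbar m n) =
        (-1) ^ (m * n * (m * n + 1) / 2) := by
  obtain ⟨I, hI⟩ := SuperInt.exists_normalizedIntegral (m := m) (n := n)
  refine ⟨⟨I, hI, fun I' hI' => SuperInt.normalizedIntegral_unique hI' hI⟩, fun I₀ hI₀ =>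
    ⟨fun h => ?_, SuperInt.isLeftIntegral_superIntegral hI₀,
      SuperInt.isRightIntegral_superIntegral hI₀, SuperInt.superIntegral_Θ hI₀⟩⟩
  have h1 := SuperInt.superIntegral_Θ hI₀
  rw [h, LinearMap.zero_apply] at h1
  exact pow_ne_zero _ (by norm_num) h1.symm
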